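/- Let $d_X,d_Y\ge 1$, let $n\in\mathbb N$, put $r=\min(d_X,d_Y)$, and let $\rho_1,\dots,\rho_r\in(0,1)$. For $d_Z\in\mathbb N$, let $\mathcal P$ be the set of jointly Gaussian distributions of $(X,Y,Z)$ on $\mathbb R^{d_X}\times\mathbb R^{d_Y}\times\mathbb R^{d_Z}$ (with arbitrary mean) whose covariance operator is injective, and let $\mathcal P_0\subset\mathcal P$ be the set of those under which $X$ and $Y$ are conditionally independent given $Z$. Suppose $d_Z\ge r$ and put $d=\lfloor d_Z/r\rfloor$. Let $Q$ be the jointly Gaussian distribution of $(X,Y,Z)$ on $\mathbb R^{d_X}\times\mathbb R^{d_Y}\times\mathbb R^{d_Z}$ under which $X$, $Y$ and $Z$ each have mean zero and identity covariance matrix, $\mathrm{Cov}(X,Z)=0$, $\mathrm{Cov}(Y,Z)=0$, and $\mathrm{Cov}(X,Y)$ is the $d_X\times d_Y$ rectangular diagonal matrix with diagonal entries $\rho_1,\dots,\rho_r$. Let $\mathcal P_0^Q$ be the set of $P\in\mathcal P_0$ for which the marginal distribution of $Z$ is the same under $P$ as under $Q$. Let $\psi$ be a (possibly randomised) test based on $n$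 i.i.d. observations, that is, a measurable function $\psi:(\mathbb R^{d_X}\times\mathbb R^{d_Y}\times\mathbb R^{d_Z})^n\to[0,1]$, of size at most $\alpha$ over $\mathcal P_0^Q$, that is, $\sup_{P\in\mathcal P_0^Q}\int\psi\,\mathrm dP^{\otimes n}\le\alpha$. Then its power $\beta=\int\psi\,\mathrm dQ^{\otimes n}$ satisfies \[ \beta\le\alpha+\frac12\sqrt{-1+\prod_{i=1}^r\left((1+\rho_i)^n\sum_{k=0}^d\frac{\binom dk}{2^d\,\bigl(1+(3-4k/d)\rho_i\bigr)^n}\right)} . \] Moreover, for fixed $n$, $d_X$, $d_Y$, $\rho_1,\dots,\rho_r$ and $\alpha$, the right-hand side converges to $\alpha$ as $d_Z\to\infty$. -/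

import Mathlib

open MeasureTheory ProbabilityTheory

namespace GaussianCI

/-- The sample space of a single observation `(X, Y, Z)`, with `X = w.1`, `Y = w.2.1` and
`Z = w.2.2`. -/
abbrev Obs (dX dY dZ : ℕ) : Type :=
  EuclideanSpace ℝ (Fin dX) × EuclideanSpace ℝ (Fin dY) × EuclideanSpace ℝ (Fin dZ)

/-- The cross-covariance matrix `Cov(U, V)` of two random vectors. -/
noncomputable def crossCov {Ω : Type*} [MeasurableSpace Ω] (μ : Measure Ω) {a b : ℕ}
    (U : Ω → EuclideanSpace ℝ (Fin a)) (V : Ω → EuclideanSpace ℝ (Fin b)) :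
    Matrix (Fin a) (Fin b) ℝ :=
  Matrix.of fun i j => cov[fun ω => U ω i, fun ω => V ω j; μ]

/-- The `a × b` rectangular diagonal matrix with diagonal entries `ρ`. -/
def rectDiagonal {a b : ℕ} (ρ : Fin (min a b) → ℝ) : Matrix (Fin a) (Fin b) ℝ :=
  Matrix.of fun i j =>
    if h : (i : ℕ) = (j : ℕ) then ρ ⟨i, lt_min i.isLt (h ▸ j.isLt)⟩ else 0

/-- The law of one observation in the model: jointly Gaussian, with injective covariance
operator. The covariance of `P` is taken as an operator on the dual space, sending `L` to
`M ↦ Cov(L, M)`; identifying functionals with vectors this is the usual covariance operator. -/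
structure IsModelLaw {dX dY dZ : ℕ} (P : Measure (Obs dX dY dZ)) : Prop where
  gaussian : IsGaussian P
  injective_cov : Function.Injective (covarianceBilinDual P)

/-- The law of one observation under the null hypothesis: a law of the model under which `X` and
`Y` are conditionally independent given `Z`. -/
def IsNullLaw {dX dY dZ : ℕ} (P : Measure (Obs dX dY dZ)) : Prop :=
  IsModelLaw P ∧ ∃ _ : IsFiniteMeasure P,
    CondIndepFun (MeasurableSpace.comap (fun w : Obs dX dY dZ => w.2.2) inferInstance)
      (Measurable.comap_le (measurable_snd.comp measurable_snd))
      (fun w : Obs dX dY dZ => w.1) (fun w : Obs dX dY dZ => w.2.1) P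

/-- The law of `n` i.i.d. observations with common law `P`. -/
noncomputable def sampleLaw {dX dY dZ : ℕ} (n : ℕ) (P : Measure (Obs dX dY dZ)) :
    Measure (Fin n → Obs dX dY dZ) :=
  Measure.pi fun _ => P

/-- The restricted null hypothesis attached to `Q`: the laws of `n` i.i.d. observations from null
laws whose marginal distribution of `Z` is the same as under `Q`. -/
def nullFamily {dX dY dZ : ℕ} (n : ℕ) (Q : Measure (Obs dX dY dZ)) :
    Set (Measure (Fin n → Obs dX dY dZ)) :=
  sampleLaw n '' {P | IsNullLaw P ∧ P.map (fun w => w.2.2) = Q.map (fun w => w.2.2)}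

/-- A (possibly randomised) test function: the value is the probability of rejection. Tests with
values in `{0, 1}` are a special case. -/
structure IsTest {Ω : Type*} [MeasurableSpace Ω] (ψ : Ω → ℝ) : Prop where
  measurable : Measurable ψ
  mem_Icc : ∀ x, ψ x ∈ Set.Icc (0 : ℝ) 1

/-- The rejection probability of the test `ψ` under `P`. -/
noncomputable def rejectionProb {Ω : Type*} [MeasurableSpace Ω] (ψ : Ω → ℝ) (P : Measure Ω) : ℝ :=
  ∫ x, ψ x ∂P

/-- The size of the test `ψ` over the family `H`: its largest rejection probability. -/
noncomputable def testSize {Ω : Type*} [MeasurableSpace Ω] (ψ : Ω → ℝ) (H : Set (Measure Ω)) : ℝ :=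
  sSup (rejectionProb ψ '' H)

/-- The alternative: `(X, Y, Z)` is jointly Gaussian, `X`, `Y`, `Z` have mean zero and identity
covariance, `Cov(X, Z) = 0`, `Cov(Y, Z) = 0`, and `Cov(X, Y)` is rectangular diagonal with
diagonal `ρ`. -/
structure IsStandardLaw {dX dY dZ : ℕ} (ρ : Fin (min dX dY) → ℝ)
    (Q : Measure (Obs dX dY dZ)) : Prop where
  gaussian : IsGaussian Q
  mean_X : ∫ w, w.1 ∂Q = 0
  mean_Y : ∫ w, w.2.1 ∂Q = 0
  mean_Z : ∫ w, w.2.2 ∂Q = 0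
  cov_X : crossCov Q (fun w => w.1) (fun w => w.1) = 1
  cov_Y : crossCov Q (fun w => w.2.1) (fun w => w.2.1) = 1
  cov_Z : crossCov Q (fun w => w.2.2) (fun w => w.2.2) = 1
  cov_XZ : crossCov Q (fun w => w.1) (fun w => w.2.2) = 0
  cov_YZ : crossCov Q (fun w => w.2.1) (fun w => w.2.2) = 0
  cov_XY : crossCov Q (fun w => w.1) (fun w => w.2.1) = rectDiagonal ρ

/-- The upper bound on the power of a size `α` test, with `d = ⌊dZ / r⌋`. -/
noncomputable def powerBound {r : ℕ} (n : ℕ) (ρ : Fin r → ℝ) (dZ : ℕ) (α : ℝ) : ℝ :=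
  let d : ℕ := dZ / r
  α + 1 / 2 * √(-1 + ∏ i, ((1 + ρ i) ^ n *
    ∑ k ∈ Finset.range (d + 1),
      (d.choose k : ℝ) / (2 ^ d * (1 + (3 - 4 * (k : ℝ) / (d : ℝ)) * ρ i) ^ n)))

end GaussianCI

namespace GaussianCI

open scoped ENNReal NNReal symmDiff

variable {dX dY dZ : ℕ}

/-! ### Product measures and densities -/

/-! The method is Le Cam's: the single alternative `Q` is compared with a mixture of null laws. For
orthonormal vectors `a i` in the space of `Z`, the law given by `confound ρ a` has `X i = √(ρ i) ⟨a
i, Z⟩ + noise` and likewise `Y i`, all noises being independent. Then `X` and `Y` are independent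
given `Z`, while `(X, Y)` and `Z` each have the same marginal law as under `Q`; only the direction
`a i` betrays the difference. Averaging over many nearly orthogonal directions hides it.

The rejection probability under `Q` exceeds its average over the mixture by at most half an L¹
distance, hence by half the root of `-1` plus the mean of `∫ L_a L_a'` over pairs of directions,
`L_a` being the likelihood ratio (`rejectionProb_le_of_mixture`).

To find `L_a`: since `Z` enters `X i` and `Y i` with equal coefficients, only the component along `X
i + Y i` sees it. The map `correlate` carries `stdLaw` to `Q` and sends one standard coordinate to
that component, so on the source `L_a` is a product of one-dimensional Gaussian ratios with
parameter `t i = explained (ρ i)` (`map_confound_eq`). Gaussian integration then gives `∏ i, (1 - c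
i * t i)⁻¹` per observation, where `c i = ⟨a i, a' i⟩` (`lintegral_shearDensity_mul_shearDensity`).

The directions are normalised sign vectors on disjoint blocks of `d` coordinates. For two uniform
sign patterns `c i = 1 - 2 m / d` with `m` binomial `(d, 1/2)`, independently over `i`
(`average_prod_symmDiff`); averaging the `n`-th powers gives the stated bound. As `d → ∞` the
overlap concentrates at `c i = 0`, where the factor is `1` (`tendsto_sum_choose`). -/

lemma lintegral_pi_prod {ι : Type*} [Fintype ι] {E : ι → Type*} [∀ i, MeasurableSpace (E i)]
    (μ : ∀ i, Measure (E i)) [∀ i, IsProbabilityMeasure (μ i)] {f : ∀ i, E i → ℝ≥0∞}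
    (hf : ∀ i, Measurable (f i)) :
    ∫⁻ x, ∏ i, f i (x i) ∂Measure.pi μ = ∏ i, ∫⁻ x, f i x ∂μ i := by
  have hind : iIndepFun (fun i (x : ∀ i, E i) => f i (x i)) (Measure.pi μ) :=
    iIndepFun_pi (X := f) fun i => (hf i).aemeasurable
  have h := lintegral_prod_eq_prod_lintegral_of_indepFun Finset.univ _ hind
    (fun i => (hf i).comp (measurable_pi_apply i))
  rw [h]
  refine Finset.prod_congr rfl fun i _ => ?_
  exact (measurePreserving_eval μ i).lintegral_comp (hf i)

/-- Boxes determine a product measure, and the indicator of a box times the product density is again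
a product, so its integral factors. -/
lemma pi_withDensity {ι : Type*} [Fintype ι] {E : ι → Type*} [∀ i, MeasurableSpace (E i)]
    (μ : ∀ i, Measure (E i)) [∀ i, IsProbabilityMeasure (μ i)] {f : ∀ i, E i → ℝ≥0∞}
    (hf : ∀ i, Measurable (f i)) [∀ i, SigmaFinite ((μ i).withDensity (f i))] :
    Measure.pi (fun i => (μ i).withDensity (f i)) =
      (Measure.pi μ).withDensity fun x => ∏ i, f i (x i) := by
  refine Measure.pi_eq fun s hs => ?_
  rw [withDensity_apply _ (MeasurableSet.univ_pi hs),
    ← lintegral_indicator (MeasurableSet.univ_pi hs)]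
  have h : ∀ x, (Set.univ.pi s).indicator (fun x => ∏ i, f i (x i)) x =
      ∏ i, (s i).indicator (f i) (x i) := by
    intro x
    by_cases hx : x ∈ Set.univ.pi s
    · rw [Set.indicator_of_mem hx]
      exact Finset.prod_congr rfl fun i _ =>
        (Set.indicator_of_mem (hx i (Set.mem_univ i)) _).symm
    · rw [Set.indicator_of_notMem hx]
      simp only [Set.mem_pi, Set.mem_univ, true_implies, not_forall] at hx
      obtain ⟨i, hi⟩ := hx
      exact (Finset.prod_eq_zero (Finset.mem_univ i) (Set.indicator_of_notMem hi _)).symm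
  simp_rw [h]
  rw [lintegral_pi_prod μ fun i => (hf i).indicator (hs i)]
  refine Finset.prod_congr rfl fun i _ => ?_
  rw [withDensity_apply _ (hs i), lintegral_indicator (hs i)]

/-! ### The second moment method for a mixture of alternatives -/

/-- This is nonnegativity of the variance of `|g|`. -/
lemma integral_abs_le_sqrt {Ω : Type*} [MeasurableSpace Ω] {μ : Measure Ω}
    [IsProbabilityMeasure μ] {g : Ω → ℝ} (hg : MemLp g 2 μ) :
    ∫ x, |g x| ∂μ ≤ √(∫ x, g x ^ 2 ∂μ) := by
  have h := variance_nonneg (fun x => |g x|) μ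
  rw [variance_eq_sub (by simpa using hg.norm)] at h
  refine Real.le_sqrt_of_sq_le ?_
  simpa using h

/-- With `F` the average of the densities `f a`, the two rejection probabilities differ by at most
`1 / 2 * ∫ |1 - F|`, and `∫ (1 - F) ^ 2` is the second moment of `F` minus `1`. -/
lemma rejectionProb_le_of_mixture {Ω ι : Type*} [MeasurableSpace Ω] [Fintype ι] [Nonempty ι]
    {μ : Measure Ω} [IsProbabilityMeasure μ] {ψ : Ω → ℝ} (hψ : IsTest ψ) {f : ι → Ω → ℝ}
    (hf1 : ∀ a, ∫ x, f a x ∂μ = 1) (hf2 : ∀ a, MemLp (f a) 2 μ) {K : ι → ι → ℝ}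
    (hK : ∀ a b, ∫ x, f a x * f b x ∂μ = K a b) {α : ℝ}
    (hα : ∀ a, ∫ x, ψ x * f a x ∂μ ≤ α) :
    ∫ x, ψ x ∂μ ≤
      α + 1 / 2 * √(-1 + (Fintype.card ι : ℝ)⁻¹ ^ 2 * ∑ a, ∑ b, K a b) := by
  set N : ℝ := (Fintype.card ι : ℝ) with hN
  have hN0 : N ≠ 0 := by simp [hN]
  have hNpos : 0 < N := by positivity
  set F : Ω → ℝ := fun x => N⁻¹ * ∑ a, f a x with hF
  have hF2 : MemLp F 2 μ := (memLp_finsetSum _ fun a _ => hf2 a).const_mul _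
  have hfi : ∀ a, Integrable (f a) μ := fun a => (hf2 a).integrable (by norm_num)
  have hFi : Integrable F μ := hF2.integrable (by norm_num)
  have hFint : ∫ x, F x ∂μ = 1 := by
    rw [hF, integral_const_mul, integral_finsetSum _ fun a _ => hfi a]
    simp [hf1, ← hN, hN0]
  have hψb : ∀ x, ‖ψ x‖ ≤ 1 := fun x => by
    rw [Real.norm_eq_abs, abs_of_nonneg (hψ.mem_Icc x).1]; exact (hψ.mem_Icc x).2
  have hψF : ∀ {g : Ω → ℝ}, Integrable g μ → Integrable (fun x => ψ x * g x) μ := fun hg =>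
    hg.bdd_mul hψ.measurable.aestronglyMeasurable (.of_forall hψb)
  have hψi : Integrable ψ μ := by simpa using hψF (integrable_const (1 : ℝ))
  have hmix : ∫ x, ψ x * F x ∂μ ≤ α := by
    have : (fun x => ψ x * F x) = fun x => N⁻¹ * ∑ a, ψ x * f a x := by
      ext x; rw [hF, ← Finset.mul_sum]; ring
    rw [this, integral_const_mul, integral_finsetSum _ fun a _ => hψF (hfi a)]
    calc N⁻¹ * ∑ a, ∫ x, ψ x * f a x ∂μ ≤ N⁻¹ * ∑ _a : ι, α := by
          gcongr with a; exact hα a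
      _ = α := by simp [← hN, hN0]
  have hsub : MemLp (fun x => 1 - F x) 2 μ := (memLp_const 1).sub hF2
  have hsubi : Integrable (fun x => 1 - F x) μ := hsub.integrable (by norm_num)
  have hsq : ∫ x, (1 - F x) ^ 2 ∂μ = -1 + N⁻¹ ^ 2 * ∑ a, ∑ b, K a b := by
    have h1 : (fun x => (1 - F x) ^ 2) = fun x => 1 - 2 * F x + F x ^ 2 := by
      ext x; ring
    have h2 : (fun x => F x ^ 2) = fun x => N⁻¹ ^ 2 * ∑ a, ∑ b, f a x * f b x := by
      ext x; rw [hF, mul_pow, sq (∑ a, f a x), Finset.sum_mul_sum]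
    have hFsq : Integrable (fun x => F x ^ 2) μ := hF2.integrable_sq
    have hprod : ∀ a b, Integrable (fun x => f a x * f b x) μ := fun a b =>
      (hf2 a).integrable_mul (hf2 b)
    have hi : Integrable (fun x => 1 - 2 * F x) μ := (integrable_const _).sub (hFi.const_mul 2)
    rw [h1, integral_add hi hFsq,
      integral_sub (integrable_const _) (hFi.const_mul 2), integral_const_mul, hFint, h2,
      integral_const_mul, integral_finsetSum _ fun a _ => integrable_finsetSum _ fun b _ =>
        hprod a b]
    simp_rw [integral_finsetSum _ fun b _ => hprod _ b, hK]
    simp; ring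
  -- Since `1 - F` integrates to zero, `ψ` may be centred at `1 / 2`; then `|ψ - 1 / 2| ≤ 1 / 2`,
  -- which is where the factor one half comes from.
  have hdiff : ∫ x, ψ x ∂μ - ∫ x, ψ x * F x ∂μ = ∫ x, (ψ x - 1 / 2) * (1 - F x) ∂μ := by
    have h1 : (fun x => (ψ x - 1 / 2) * (1 - F x)) =
        fun x => ψ x - ψ x * F x - 1 / 2 * (1 - F x) := by ext x; ring
    have hi : Integrable (fun x => ψ x - ψ x * F x) μ := hψi.sub (hψF hFi)
    rw [h1, integral_sub hi (hsubi.const_mul _), integral_sub hψi (hψF hFi),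
      integral_const_mul, integral_sub (integrable_const _) hFi, hFint]
    simp
  have habs : ∫ x, (ψ x - 1 / 2) * (1 - F x) ∂μ ≤ 1 / 2 * ∫ x, |1 - F x| ∂μ := by
    rw [← integral_const_mul]
    refine integral_mono ?_ (hsubi.abs.const_mul _) fun x => ?_
    · have h1 : (fun x => (ψ x - 1 / 2) * (1 - F x)) =
          fun x => ψ x * (1 - F x) - 1 / 2 * (1 - F x) := by ext x; ring
      rw [h1]
      exact (hψF hsubi).sub (hsubi.const_mul _)
    · calc (ψ x - 1 / 2) * (1 - F x) ≤ |(ψ x - 1 / 2) * (1 - F x)| := le_abs_self _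
        _ = |ψ x - 1 / 2| * |1 - F x| := abs_mul _ _
        _ ≤ 1 / 2 * |1 - F x| := by
          gcongr
          have := hψ.mem_Icc x
          exact abs_le.2 ⟨by linarith [this.1], by linarith [this.2]⟩
  have := integral_abs_le_sqrt hsub
  rw [hsq] at this
  linarith

/-! ### One-dimensional Gaussian integrals -/

/-- The density of `N(√t w, 1 - t)` with respect to the standard normal law. -/
noncomputable def shiftDensity (t w u : ℝ) : ℝ :=
  (√(1 - t))⁻¹ * Real.exp (-(u - √t * w) ^ 2 / (2 * (1 - t)) + u ^ 2 / 2)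

lemma shiftDensity_nonneg (t w u : ℝ) : 0 ≤ shiftDensity t w u := by
  unfold shiftDensity; positivity

@[fun_prop]
lemma measurable_shiftDensity {Ω : Type*} [MeasurableSpace Ω] (t : ℝ) {f g : Ω → ℝ}
    (hf : Measurable f) (hg : Measurable g) :
    Measurable fun x => shiftDensity t (f x) (g x) := by
  unfold shiftDensity; fun_prop

lemma map_shift_gaussianReal {t : ℝ} (ht1 : t < 1) (w : ℝ) :
    (gaussianReal 0 1).map (fun u => √t * w + √(1 - t) * u) =
      (gaussianReal 0 1).withDensity fun u => ENNReal.ofReal (shiftDensity t w u) := by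
  have h1t : 0 < 1 - t := by linarith
  have hcomp : (fun u => √t * w + √(1 - t) * u) =
      (fun u => √t * w + u) ∘ fun u => √(1 - t) * u := rfl
  rw [hcomp, ← Measure.map_map (by fun_prop) (by fun_prop), gaussianReal_map_const_mul,
    gaussianReal_map_const_add]
  -- From here the variance is a variable known through its real value `1 - t`.
  obtain ⟨v, hv⟩ : ∃ v, v = NNReal.mk (√(1 - t) ^ 2) (sq_nonneg _) * 1 := ⟨_, rfl⟩
  have hv' : (v : ℝ) = 1 - t := by rw [hv, mul_one, NNReal.coe_mk, Real.sq_sqrt h1t.le]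
  rw [← hv]
  have hv0 : v ≠ 0 := by
    intro h; rw [h] at hv'; simp at hv'; linarith
  rw [gaussianReal_of_var_ne_zero _ hv0, gaussianReal_of_var_ne_zero _ one_ne_zero,
    ← withDensity_mul _ (measurable_gaussianPDF _ _) (by fun_prop)]
  congr 1
  ext u
  rw [Pi.mul_apply, gaussianPDF, gaussianPDF, ← ENNReal.ofReal_mul (gaussianPDFReal_nonneg _ _ _)]
  congr 1
  rw [gaussianPDFReal, gaussianPDFReal, shiftDensity, hv']
  have hs : √(2 * Real.pi * (1 - t)) = √(2 * Real.pi * ((1 : ℝ≥0) : ℝ)) * √(1 - t) := by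
    rw [← Real.sqrt_mul (by positivity)]; simp
  have he : Real.exp (-(u - (√(1 - t) * 0 + √t * w)) ^ 2 / (2 * (1 - t))) =
      Real.exp (-(u - 0) ^ 2 / (2 * ((1 : ℝ≥0) : ℝ))) *
        Real.exp (-(u - √t * w) ^ 2 / (2 * (1 - t)) + u ^ 2 / 2) := by
    rw [← Real.exp_add]
    congr 1
    simp
    ring
  rw [hs, he, mul_inv]
  ring

/-- Completing the square turns the integrand into a constant times the density of `N(b v / e, v /
e)`, `e = 1 - 2 a v > 0`. The degenerate case `v = 0` is included because the half sum or half
difference of two unit directions may vanish. -/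
lemma lintegral_exp_quadratic_gaussianReal (v : ℝ≥0) {a : ℝ} (b : ℝ) (h : 2 * a * v < 1) :
    ∫⁻ x, ENNReal.ofReal (Real.exp (a * x ^ 2 + b * x)) ∂gaussianReal 0 v =
      ENNReal.ofReal ((√(1 - 2 * a * v))⁻¹ * Real.exp (b ^ 2 * v / (2 * (1 - 2 * a * v)))) := by
  rcases eq_or_ne v 0 with rfl | hv
  · simp
  have hvpos : (0 : ℝ) < v := by positivity
  set e : ℝ := 1 - 2 * a * v with he
  have hepos : 0 < e := by linarith
  set v' : ℝ≥0 := ⟨v / e, by positivity⟩ with hv'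
  have hv'c : (v' : ℝ) = v / e := rfl
  have hv'0 : v' ≠ 0 := by
    intro h0; rw [h0] at hv'c
    have : (0 : ℝ) < v / e := by positivity
    rw [← hv'c] at this
    exact this.false
  rw [gaussianReal_of_var_ne_zero _ hv,
    lintegral_withDensity_eq_lintegral_mul _ (measurable_gaussianPDF _ _) (by fun_prop)]
  have key : ∀ x, (gaussianPDF 0 v * fun x => ENNReal.ofReal (Real.exp (a * x ^ 2 + b * x))) x =
      ENNReal.ofReal ((√e)⁻¹ * Real.exp (b ^ 2 * v / (2 * e))) *
        gaussianPDF (b * v / e) v' x := by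
    intro x
    rw [Pi.mul_apply, gaussianPDF, gaussianPDF,
      ← ENNReal.ofReal_mul (gaussianPDFReal_nonneg _ _ _), ← ENNReal.ofReal_mul (by positivity)]
    congr 1
    rw [gaussianPDFReal, gaussianPDFReal, hv'c]
    have hs : √(2 * Real.pi * v) = √(2 * Real.pi * (v / e)) * √e := by
      rw [← Real.sqrt_mul (by positivity)]; congr 1; field_simp
    have hx : Real.exp (-(x - 0) ^ 2 / (2 * v)) * Real.exp (a * x ^ 2 + b * x) =
        Real.exp (b ^ 2 * v / (2 * e)) *
          Real.exp (-(x - b * v / e) ^ 2 / (2 * (v / e))) := by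
      rw [← Real.exp_add, ← Real.exp_add]
      congr 1
      have ha : a = (1 - e) / (2 * v) := by rw [he]; field_simp; ring
      rw [ha]
      field_simp
      ring
    rw [hs, mul_assoc, hx, mul_inv]
    ring
  simp_rw [key]
  rw [lintegral_const_mul _ (measurable_gaussianPDF _ _), lintegral_gaussianPDF_eq_one _ hv'0,
    mul_one]

/-- Writing the two means as `p ± q` removes the cross term: the result is a function of `p` times a
function of `q`, ready to be integrated against independent `p` and `q`. -/
lemma lintegral_shiftDensity_mul_shiftDensity {t : ℝ} (ht0 : 0 ≤ t) (ht1 : t < 1) (p q : ℝ) :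
    ∫⁻ u, ENNReal.ofReal (shiftDensity t (p + q) u * shiftDensity t (p - q) u)
        ∂gaussianReal 0 1 =
      ENNReal.ofReal ((√(1 - t ^ 2))⁻¹ *
        (Real.exp (t / (1 + t) * p ^ 2) * Real.exp (-(t / (1 - t)) * q ^ 2))) := by
  have h1t : 0 < 1 - t := by linarith
  have h1t' : 0 < 1 + t := by linarith
  have key : ∀ u, ENNReal.ofReal (shiftDensity t (p + q) u * shiftDensity t (p - q) u) =
      ENNReal.ofReal ((1 - t)⁻¹ * Real.exp (-(t * (p ^ 2 + q ^ 2) / (1 - t)))) *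
        ENNReal.ofReal (Real.exp (-(t / (1 - t)) * u ^ 2 + 2 * √t * p / (1 - t) * u)) := by
    intro u
    rw [← ENNReal.ofReal_mul (by positivity)]
    congr 1
    unfold shiftDensity
    rw [mul_mul_mul_comm, ← mul_inv, Real.mul_self_sqrt h1t.le, ← Real.exp_add, mul_assoc,
      ← Real.exp_add]
    congr 2
    -- Putting `t = s * s` with `s = √t` makes the identity between exponents a rational one in `s`.
    have hs : √t * √t = t := Real.mul_self_sqrt ht0
    generalize √t = s at hs ⊢
    rw [← hs] at h1t ⊢
    have h1s : 1 - s ^ 2 ≠ 0 := by rw [sq]; exact h1t.ne'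
    rw [← sub_eq_zero]
    field_simp
    ring
  have hlt : 2 * -(t / (1 - t)) * ((1 : ℝ≥0) : ℝ) < 1 := by
    have : 0 ≤ t / (1 - t) := by positivity
    simp; linarith
  simp_rw [key]
  rw [lintegral_const_mul _ (by fun_prop), lintegral_exp_quadratic_gaussianReal 1 _ hlt,
    ← ENNReal.ofReal_mul (by positivity)]
  congr 1
  have he : 1 - 2 * -(t / (1 - t)) * ((1 : ℝ≥0) : ℝ) = (1 + t) / (1 - t) := by
    simp; field_simp; ring
  rw [he]
  have hsq : (1 - t)⁻¹ * (√((1 + t) / (1 - t)))⁻¹ = (√(1 - t ^ 2))⁻¹ := by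
    rw [← mul_inv]
    congr 1
    rw [show 1 - t ^ 2 = (1 - t) ^ 2 * ((1 + t) / (1 - t)) by field_simp; ring,
      Real.sqrt_mul (sq_nonneg _), Real.sqrt_sq h1t.le]
  rw [mul_mul_mul_comm, hsq, ← Real.exp_add, ← Real.exp_add]
  congr 2
  have hs : √t ^ 2 = t := Real.sq_sqrt ht0
  have : (2 * √t * p / (1 - t)) ^ 2 = 4 * t * p ^ 2 / (1 - t) ^ 2 := by
    rw [div_pow, mul_pow, mul_pow, hs]; ring
  rw [this]
  simp only [NNReal.coe_one]
  field_simp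
  ring

/-- The variances are those of the half sum and half difference of two standard normals with
correlation `c`. The three square roots combine because `(1 - t ^ 2) * ((1 - c * t) / (1 + t)) * ((1
- c * t) / (1 - t)) = (1 - c * t) ^ 2`. -/
lemma lintegral_mixed_quadratic {t c : ℝ} (ht0 : 0 ≤ t) (ht1 : t < 1) {v₁ v₂ : ℝ≥0}
    (h₁ : (v₁ : ℝ) = (1 + c) / 2) (h₂ : (v₂ : ℝ) = (1 - c) / 2) :
    ENNReal.ofReal (√(1 - t ^ 2))⁻¹ *
        ((∫⁻ p, ENNReal.ofReal (Real.exp (t / (1 + t) * p ^ 2)) ∂gaussianReal 0 v₁) *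
          ∫⁻ q, ENNReal.ofReal (Real.exp (-(t / (1 - t)) * q ^ 2)) ∂gaussianReal 0 v₂) =
      ENNReal.ofReal (1 - c * t)⁻¹ := by
  have h1t : 0 < 1 - t := by linarith
  have h1t' : 0 < 1 + t := by linarith
  have hc1 : c ≤ 1 := by have := v₂.coe_nonneg; linarith
  have hct : 0 < 1 - c * t := by nlinarith
  have e₁ : 1 - 2 * (t / (1 + t)) * v₁ = (1 - c * t) / (1 + t) := by
    rw [h₁]; field_simp; ring
  have e₂ : 1 - 2 * (-(t / (1 - t))) * v₂ = (1 - c * t) / (1 - t) := by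
    rw [h₂]; field_simp; ring
  have p₁ : 0 < (1 - c * t) / (1 + t) := by positivity
  have p₂ : 0 < (1 - c * t) / (1 - t) := by positivity
  have i₁ := lintegral_exp_quadratic_gaussianReal v₁ (a := t / (1 + t)) 0 (by linarith)
  have i₂ := lintegral_exp_quadratic_gaussianReal v₂ (a := -(t / (1 - t))) 0 (by linarith)
  simp only [zero_mul, add_zero, ne_eq, OfNat.ofNat_ne_zero, not_false_eq_true, zero_pow,
    zero_div, Real.exp_zero, mul_one] at i₁ i₂
  rw [i₁, i₂, e₁, e₂, ← ENNReal.ofReal_mul (by positivity), ← ENNReal.ofReal_mul (by positivity),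
    ← mul_inv, ← mul_inv, ← Real.sqrt_mul p₁.le, ← Real.sqrt_mul (by nlinarith)]
  congr 2
  rw [show (1 - t ^ 2) * ((1 - c * t) / (1 + t) * ((1 - c * t) / (1 - t))) = (1 - c * t) ^ 2 by
    field_simp; ring, Real.sqrt_sq hct.le]

/-! ### Standard laws -/


/-- The coordinate functionals on the sample space. -/
noncomputable def coord : Fin dX ⊕ Fin dY ⊕ Fin dZ → Obs dX dY dZ →L[ℝ] ℝ
  | .inl i => (EuclideanSpace.proj i).comp (.fst ℝ _ _)
  | .inr (.inl j) => (EuclideanSpace.proj j).comp ((ContinuousLinearMap.fst ℝ _ _).comp (.snd ℝ _ _))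
  | .inr (.inr k) => (EuclideanSpace.proj k).comp ((ContinuousLinearMap.snd ℝ _ _).comp (.snd ℝ _ _))

@[simp] lemma coord_inl (i : Fin dX) (w : Obs dX dY dZ) : coord (.inl i) w = w.1 i := rfl
@[simp] lemma coord_inr_inl (j : Fin dY) (w : Obs dX dY dZ) :
    coord (.inr (.inl j)) w = w.2.1 j := rfl
@[simp] lemma coord_inr_inr (k : Fin dZ) (w : Obs dX dY dZ) :
    coord (.inr (.inr k)) w = w.2.2 k := rfl

lemma exists_eq_sum_apply {n : ℕ} (L : EuclideanSpace ℝ (Fin n) →L[ℝ] ℝ) :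
    ∃ c : Fin n → ℝ, ∀ x, L x = ∑ i, c i * x i := by
  refine ⟨fun i => L (EuclideanSpace.basisFun (Fin n) ℝ i), fun x => ?_⟩
  conv_lhs => rw [← (EuclideanSpace.basisFun (Fin n) ℝ).sum_repr x]
  simp [mul_comm]

lemma exists_eq_sum_coord (L : Obs dX dY dZ →L[ℝ] ℝ) :
    ∃ c : Fin dX ⊕ Fin dY ⊕ Fin dZ → ℝ, ∀ w, L w = ∑ k, c k * coord k w := by
  obtain ⟨c₁, h₁⟩ := exists_eq_sum_apply (L.comp (.inl ℝ _ _))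
  obtain ⟨c₂, h₂⟩ := exists_eq_sum_apply
    (L.comp ((ContinuousLinearMap.inr ℝ _ _).comp (.inl ℝ _ _)))
  obtain ⟨c₃, h₃⟩ := exists_eq_sum_apply
    (L.comp ((ContinuousLinearMap.inr ℝ _ _).comp (.inr ℝ _ _)))
  refine ⟨Sum.elim c₁ (Sum.elim c₂ c₃), fun w => ?_⟩
  have hw : w = (w.1, 0, 0) + ((0, w.2.1, 0) + (0, 0, w.2.2)) := by ext <;> simp
  have e₁ : L (w.1, 0, 0) = _ := h₁ w.1
  have e₂ : L (0, w.2.1, 0) = _ := h₂ w.2.1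
  have e₃ : L (0, 0, w.2.2) = _ := h₃ w.2.2
  conv_lhs => rw [hw, map_add, map_add, e₁, e₂, e₃]
  simp

/-- The covariance matrix of a standard law, in the coordinates `coord`. -/
noncomputable def standardCov (ρ : Fin (min dX dY) → ℝ) :
    Fin dX ⊕ Fin dY ⊕ Fin dZ → Fin dX ⊕ Fin dY ⊕ Fin dZ → ℝ
  | .inl i, .inl j => (1 : Matrix _ _ ℝ) i j
  | .inl i, .inr (.inl j) => rectDiagonal ρ i j
  | .inr (.inl i), .inl j => rectDiagonal ρ j i
  | .inr (.inl i), .inr (.inl j) => (1 : Matrix _ _ ℝ) i j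
  | .inr (.inr i), .inr (.inr j) => (1 : Matrix _ _ ℝ) i j
  | _, _ => 0

lemma standardCov_zero (k l : Fin dX ⊕ Fin dY ⊕ Fin dZ) :
    standardCov 0 k l = if k = l then 1 else 0 := by
  rcases k with i | i | i <;> rcases l with j | j | j <;>
    simp [standardCov, rectDiagonal, Matrix.one_apply]

lemma IsStandardLaw.covariance_coord {ρ : Fin (min dX dY) → ℝ} {Q : Measure (Obs dX dY dZ)}
    (hQ : IsStandardLaw ρ Q) (k l : Fin dX ⊕ Fin dY ⊕ Fin dZ) :
    cov[coord k, coord l; Q] = standardCov ρ k l := by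
  rcases k with i | i | i <;> rcases l with j | j | j
  · exact congrFun₂ hQ.cov_X i j
  · exact congrFun₂ hQ.cov_XY i j
  · exact congrFun₂ hQ.cov_XZ i j
  · rw [covariance_comm]; exact congrFun₂ hQ.cov_XY j i
  · exact congrFun₂ hQ.cov_Y i j
  · exact congrFun₂ hQ.cov_YZ i j
  · rw [covariance_comm]; exact congrFun₂ hQ.cov_XZ j i
  · rw [covariance_comm]; exact congrFun₂ hQ.cov_YZ j i
  · exact congrFun₂ hQ.cov_Z i j

lemma IsStandardLaw.integral_coord {ρ : Fin (min dX dY) → ℝ} {Q : Measure (Obs dX dY dZ)}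
    (hQ : IsStandardLaw ρ Q) (k : Fin dX ⊕ Fin dY ⊕ Fin dZ) : ∫ w, coord k w ∂Q = 0 := by
  have := hQ.gaussian
  have hi : Integrable (fun w : Obs dX dY dZ => w) Q := IsGaussian.integrable_id
  have hX : (∫ w, w ∂Q).1 = 0 := by rw [fst_integral hi, hQ.mean_X]
  have hY : (∫ w, w ∂Q).2.1 = 0 := by rw [snd_integral hi, fst_integral hi.snd, hQ.mean_Y]
  have hZ : (∫ w, w ∂Q).2.2 = 0 := by rw [snd_integral hi, snd_integral hi.snd, hQ.mean_Z]
  rw [(coord k).integral_comp_comm hi]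
  rcases k with i | i | i <;> simp [hX, hY, hZ]

lemma memLp_coord (Q : Measure (Obs dX dY dZ)) [IsGaussian Q] (k : Fin dX ⊕ Fin dY ⊕ Fin dZ) :
    MemLp (coord k) 2 Q :=
  IsGaussian.memLp_dual Q (coord k) 2 (by norm_num)

/-- A Gaussian law is determined by the mean and variance of every functional, and the functionals
in `coord` span the dual. Hence `Q` may be replaced by any convenient realisation. -/
lemma IsStandardLaw.unique {ρ : Fin (min dX dY) → ℝ} {P Q : Measure (Obs dX dY dZ)}
    (hP : IsStandardLaw ρ P) (hQ : IsStandardLaw ρ Q) : P = Q := by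
  have := hP.gaussian
  have := hQ.gaussian
  have mean : ∀ {ν : Measure (Obs dX dY dZ)}, IsStandardLaw ρ ν →
      ∀ c : Fin dX ⊕ Fin dY ⊕ Fin dZ → ℝ, ∫ w, (∑ k, c k * coord k w) ∂ν = 0 := by
    intro ν hν c
    have := hν.gaussian
    have hi : ∀ k, Integrable (fun w => c k * coord k w) ν := fun k =>
      (IsGaussian.integrable_dual ν (coord k)).const_mul _
    rw [integral_finsetSum _ fun k _ => hi k]
    simp [integral_const_mul, hν.integral_coord]
  have var : ∀ {ν : Measure (Obs dX dY dZ)}, IsStandardLaw ρ ν →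
      ∀ c : Fin dX ⊕ Fin dY ⊕ Fin dZ → ℝ, Var[fun w => ∑ k, c k * coord k w; ν] =
        ∑ k, ∑ l, c k * (c l * standardCov ρ k l) := by
    intro ν hν c
    have := hν.gaussian
    have hm : ∀ k, MemLp (fun w => c k * coord k w) 2 ν := fun k => (memLp_coord ν k).const_mul _
    rw [← covariance_self (memLp_finsetSum _ fun k _ => hm k).aemeasurable,
      covariance_fun_sum_fun_sum hm hm]
    simp_rw [covariance_const_mul_left, covariance_const_mul_right]
    refine Finset.sum_congr rfl fun k _ => Finset.sum_congr rfl fun l _ => ?_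
    rw [← hν.covariance_coord]
  refine Measure.ext_of_charFunDual ?_
  ext L
  obtain ⟨c, hc⟩ := exists_eq_sum_coord L
  have hL : (L : Obs dX dY dZ → ℝ) = fun w => ∑ k, c k * coord k w := funext hc
  rw [IsGaussian.charFunDual_eq, IsGaussian.charFunDual_eq, integral_complex_ofReal,
    integral_complex_ofReal, hL, mean hP, mean hQ, var hP, var hQ]

/-- The law under which all coordinates are independent standard normal variables. -/
noncomputable def stdLaw (dX dY dZ : ℕ) : Measure (Obs dX dY dZ) :=
  (stdGaussian (EuclideanSpace ℝ (Fin dX))).prod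
    ((stdGaussian (EuclideanSpace ℝ (Fin dY))).prod (stdGaussian (EuclideanSpace ℝ (Fin dZ))))

instance : IsGaussian (stdLaw dX dY dZ) := by unfold stdLaw; infer_instance

lemma covariance_stdGaussian {n : ℕ} (i j : Fin n) :
    cov[fun x => x i, fun x => x j; stdGaussian (EuclideanSpace ℝ (Fin n))] =
      (1 : Matrix _ _ ℝ) i j := by
  have h := covarianceBilin_apply_eq_cov (μ := stdGaussian (EuclideanSpace ℝ (Fin n)))
    IsGaussian.memLp_two_id (EuclideanSpace.basisFun (Fin n) ℝ i)
    (EuclideanSpace.basisFun (Fin n) ℝ j)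
  rw [covarianceBilin_stdGaussian, innerSL_apply_apply, OrthonormalBasis.inner_eq_ite] at h
  rw [Matrix.one_apply, h]
  congr 1 <;> ext x <;> simp [EuclideanSpace.inner_single_left]

lemma isStandardLaw_stdLaw : IsStandardLaw 0 (stdLaw dX dY dZ) := by
  have hfst : MeasurePreserving Prod.fst (stdLaw dX dY dZ) (stdGaussian _) := measurePreserving_fst
  have hsnd : MeasurePreserving Prod.snd (stdLaw dX dY dZ)
    ((stdGaussian (EuclideanSpace ℝ (Fin dY))).prod (stdGaussian (EuclideanSpace ℝ (Fin dZ)))) :=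
    measurePreserving_snd
  have hY : MeasurePreserving (fun w => w.2.1) (stdLaw dX dY dZ) (stdGaussian _) :=
    measurePreserving_fst.comp hsnd
  have hZ : MeasurePreserving (fun w => w.2.2) (stdLaw dX dY dZ) (stdGaussian _) :=
    measurePreserving_snd.comp hsnd
  have mean : ∀ {n : ℕ} {f : Obs dX dY dZ → EuclideanSpace ℝ (Fin n)},
      MeasurePreserving f (stdLaw dX dY dZ) (stdGaussian _) → ∫ w, f w ∂stdLaw dX dY dZ = 0 := by
    intro n f hf
    rw [← integral_id_stdGaussian, ← hf.map_eq, integral_map hf.aemeasurable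
      (by fun_prop)]
  have cov : ∀ {n : ℕ} {f : Obs dX dY dZ → EuclideanSpace ℝ (Fin n)},
      MeasurePreserving f (stdLaw dX dY dZ) (stdGaussian _) →
        crossCov (stdLaw dX dY dZ) f f = 1 := by
    intro n f hf
    ext i j
    rw [← covariance_stdGaussian, ← hf.map_eq, covariance_map_fun (by fun_prop) (by fun_prop)
      hf.aemeasurable]
    rfl
  have hLp : ∀ {n : ℕ} (i : Fin n),
      MemLp (fun x => x i) 2 (stdGaussian (EuclideanSpace ℝ (Fin n))) := fun i =>
    IsGaussian.memLp_dual _ (EuclideanSpace.proj i) 2 (by norm_num)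
  have hzero : rectDiagonal (0 : Fin (min dX dY) → ℝ) = 0 := by
    ext i j; simp [rectDiagonal]
  refine ⟨inferInstance, mean hfst, mean hY, mean hZ, cov hfst, cov hY, cov hZ, ?_, ?_, ?_⟩
  · ext i k
    exact covariance_fst_snd_prod (hLp i) ((hLp k).comp_measurePreserving measurePreserving_snd)
  · ext j k
    have h := covariance_fst_snd_prod (hLp j) (hLp k)
    rw [← hsnd.map_eq, covariance_map_fun (by fun_prop) (by fun_prop) hsnd.aemeasurable] at h
    exact h
  · rw [hzero]
    ext i j
    exact covariance_fst_snd_prod (hLp i) ((hLp j).comp_measurePreserving measurePreserving_fst)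

/-- A linear map carrying the law `stdLaw` to the standard law with correlations `ρ`. -/
noncomputable def correlate (dZ : ℕ) (ρ : Fin (min dX dY) → ℝ) :
    Obs dX dY dZ →L[ℝ] Obs dX dY dZ :=
  LinearMap.toContinuousLinearMap
    { toFun := fun w =>
        (WithLp.toLp 2 fun i => if h : (i : ℕ) < min dX dY then
            √((1 + ρ ⟨i, h⟩) / 2) * w.1 i +
              √((1 - ρ ⟨i, h⟩) / 2) * w.2.1 ⟨i, h.trans_le (min_le_right _ _)⟩
          else w.1 i,
        WithLp.toLp 2 fun j => if h : (j : ℕ) < min dX dY then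
            √((1 + ρ ⟨j, h⟩) / 2) * w.1 ⟨j, h.trans_le (min_le_left _ _)⟩ +
              -√((1 - ρ ⟨j, h⟩) / 2) * w.2.1 j
          else w.2.1 j,
        w.2.2)
      map_add' := fun v w => by
        refine Prod.ext (PiLp.ext fun i => ?_) (Prod.ext (PiLp.ext fun j => ?_) rfl)
        · by_cases h : (i : ℕ) < min dX dY
          · simp only [Prod.fst_add, Prod.snd_add, PiLp.add_apply, dif_pos h]; ring
          · simp only [Prod.fst_add, PiLp.add_apply, dif_neg h]
        · by_cases h : (j : ℕ) < min dX dY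
          · simp only [Prod.fst_add, Prod.snd_add, PiLp.add_apply, dif_pos h]; ring
          · simp only [Prod.fst_add, Prod.snd_add, PiLp.add_apply, dif_neg h]
      map_smul' := fun c w => by
        refine Prod.ext (PiLp.ext fun i => ?_) (Prod.ext (PiLp.ext fun j => ?_) rfl)
        · by_cases h : (i : ℕ) < min dX dY
          · simp only [Prod.smul_fst, Prod.smul_snd, PiLp.smul_apply, dif_pos h, smul_eq_mul,
              RingHom.id_apply]
            ring
          · simp only [Prod.smul_fst, PiLp.smul_apply, dif_neg h, RingHom.id_apply]
        · by_cases h : (j : ℕ) < min dX dY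
          · simp only [Prod.smul_fst, Prod.smul_snd, PiLp.smul_apply, dif_pos h, smul_eq_mul,
              RingHom.id_apply]
            ring
          · simp only [Prod.smul_fst, Prod.smul_snd, PiLp.smul_apply, dif_neg h,
              RingHom.id_apply] }

lemma correlate_fst (ρ : Fin (min dX dY) → ℝ) (w : Obs dX dY dZ) (i : Fin dX) :
    (correlate dZ ρ w).1 i = if h : (i : ℕ) < min dX dY then
      √((1 + ρ ⟨i, h⟩) / 2) * w.1 i +
        √((1 - ρ ⟨i, h⟩) / 2) * w.2.1 ⟨i, h.trans_le (min_le_right _ _)⟩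
      else w.1 i := rfl

lemma correlate_snd_fst (ρ : Fin (min dX dY) → ℝ) (w : Obs dX dY dZ) (j : Fin dY) :
    (correlate dZ ρ w).2.1 j = if h : (j : ℕ) < min dX dY then
      √((1 + ρ ⟨j, h⟩) / 2) * w.1 ⟨j, h.trans_le (min_le_left _ _)⟩ +
        -√((1 - ρ ⟨j, h⟩) / 2) * w.2.1 j
      else w.2.1 j := rfl

@[simp] lemma correlate_snd_snd (ρ : Fin (min dX dY) → ℝ) (w : Obs dX dY dZ) :
    (correlate dZ ρ w).2.2 = w.2.2 := rfl

lemma covariance_two_coord (a b a' b' : ℝ) (k l k' l' : Fin dX ⊕ Fin dY ⊕ Fin dZ) :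
    cov[fun w => a * coord k w + b * coord l w, fun w => a' * coord k' w + b' * coord l' w;
        stdLaw dX dY dZ] =
      a * a' * (if k = k' then 1 else 0) + a * b' * (if k = l' then 1 else 0) +
        b * a' * (if l = k' then 1 else 0) + b * b' * (if l = l' then 1 else 0) := by
  have hm : ∀ (c : ℝ) k, MemLp (fun w => c * coord k w) 2 (stdLaw dX dY dZ) :=
    fun c k => (memLp_coord _ k).const_mul c
  have hc : ∀ k l, cov[fun w => coord k w, fun w => coord l w; stdLaw dX dY dZ] =
      if k = l then 1 else 0 := fun k l => by
    rw [← standardCov_zero]; exact isStandardLaw_stdLaw.covariance_coord k l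
  have hadd : ∀ {f g : Obs dX dY dZ → ℝ}, MemLp f 2 (stdLaw dX dY dZ) →
      MemLp g 2 (stdLaw dX dY dZ) → MemLp (fun w => f w + g w) 2 (stdLaw dX dY dZ) :=
    fun hf hg => hf.add hg
  have hl : ∀ {f g h : Obs dX dY dZ → ℝ}, MemLp f 2 (stdLaw dX dY dZ) →
      MemLp g 2 (stdLaw dX dY dZ) → MemLp h 2 (stdLaw dX dY dZ) →
      cov[fun w => f w + g w, h; stdLaw dX dY dZ] =
        cov[f, h; stdLaw dX dY dZ] + cov[g, h; stdLaw dX dY dZ] :=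
    fun hf hg hh => covariance_add_left hf hg hh
  have hr : ∀ {f g h : Obs dX dY dZ → ℝ}, MemLp f 2 (stdLaw dX dY dZ) →
      MemLp g 2 (stdLaw dX dY dZ) → MemLp h 2 (stdLaw dX dY dZ) →
      cov[h, fun w => f w + g w; stdLaw dX dY dZ] =
        cov[h, f; stdLaw dX dY dZ] + cov[h, g; stdLaw dX dY dZ] :=
    fun hf hg hh => covariance_add_right hh hf hg
  rw [hl (hm _ _) (hm _ _) (hadd (hm _ _) (hm _ _)), hr (hm _ _) (hm _ _) (hm _ _),
    hr (hm _ _) (hm _ _) (hm _ _)]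
  simp only [covariance_const_mul_left, covariance_const_mul_right, hc]
  ring

/-- Each mixed pair is `A U + B V`, `A U - B V` with `U`, `V` independent standard normal and `A ^ 2
= (1 + ρ) / 2`, `B ^ 2 = (1 - ρ) / 2`: the variances are `A ^ 2 + B ^ 2 = 1` and the covariance is
`A ^ 2 - B ^ 2 = ρ`. -/
lemma isStandardLaw_correlate {ρ : Fin (min dX dY) → ℝ} (hρ : ∀ i, ρ i ∈ Set.Ico (0 : ℝ) 1) :
    IsStandardLaw ρ ((stdLaw dX dY dZ).map (correlate dZ ρ)) := by
  have hmeas : AEMeasurable (correlate dZ ρ) (stdLaw dX dY dZ) := by fun_prop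
  have hi : Integrable (fun w : Obs dX dY dZ => w) (stdLaw dX dY dZ) := IsGaussian.integrable_id
  have hzero : ∫ w, w ∂stdLaw dX dY dZ = 0 := by
    ext i
    · rw [fst_integral hi, isStandardLaw_stdLaw.mean_X]; rfl
    · rw [snd_integral hi, fst_integral hi.snd, isStandardLaw_stdLaw.mean_Y]; rfl
    · rw [snd_integral hi, snd_integral hi.snd, isStandardLaw_stdLaw.mean_Z]; rfl
  have mean : ∀ {n : ℕ} (f : Obs dX dY dZ →L[ℝ] EuclideanSpace ℝ (Fin n)),
      ∫ w, f w ∂((stdLaw dX dY dZ).map (correlate dZ ρ)) = 0 := by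
    intro n f
    rw [integral_map hmeas (by fun_prop)]
    have := (f.comp (correlate dZ ρ)).integral_comp_comm hi
    rw [hzero, map_zero] at this
    exact this
  have cov : ∀ {f g : Obs dX dY dZ → ℝ}, Measurable f → Measurable g →
      cov[f, g; (stdLaw dX dY dZ).map (correlate dZ ρ)] =
        cov[fun w => f (correlate dZ ρ w), fun w => g (correlate dZ ρ w); stdLaw dX dY dZ] :=
    fun hf hg => covariance_map_fun hf.aestronglyMeasurable hg.aestronglyMeasurable hmeas
  have hX : ∀ (i : Fin dX) (h : (i : ℕ) < min dX dY),
      (fun w : Obs dX dY dZ => (correlate dZ ρ w).1 i) =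
        fun w => √((1 + ρ ⟨i, h⟩) / 2) * coord (.inl i) w +
          √((1 - ρ ⟨i, h⟩) / 2) * coord (.inr (.inl ⟨i, h.trans_le (min_le_right _ _)⟩)) w :=
    fun i h => funext fun w => dif_pos h
  -- Unmixed coordinates are padded with a zero term so that `covariance_two_coord` covers them too.
  have hX' : ∀ (i : Fin dX), ¬ (i : ℕ) < min dX dY →
      (fun w : Obs dX dY dZ => (correlate dZ ρ w).1 i) =
        fun w => 1 * coord (.inl i) w + 0 * coord (.inl i) w :=
    fun i h => funext fun w => (dif_neg h).trans (by simp)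
  have hY : ∀ (j : Fin dY) (h : (j : ℕ) < min dX dY),
      (fun w : Obs dX dY dZ => (correlate dZ ρ w).2.1 j) =
        fun w => √((1 + ρ ⟨j, h⟩) / 2) * coord (.inl ⟨j, h.trans_le (min_le_left _ _)⟩) w +
          -√((1 - ρ ⟨j, h⟩) / 2) * coord (.inr (.inl j)) w :=
    fun j h => funext fun w => dif_pos h
  have hY' : ∀ (j : Fin dY), ¬ (j : ℕ) < min dX dY →
      (fun w : Obs dX dY dZ => (correlate dZ ρ w).2.1 j) =
        fun w => 1 * coord (.inr (.inl j)) w + 0 * coord (.inr (.inl j)) w :=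
    fun j h => funext fun w => (dif_neg h).trans (by simp)
  have hZ : ∀ k : Fin dZ, (fun w : Obs dX dY dZ => (correlate dZ ρ w).2.2 k) =
      fun w => 1 * coord (.inr (.inr k)) w + 0 * coord (.inr (.inr k)) w :=
    fun k => funext fun w => by simp
  have hρa : ∀ i, √((1 + ρ i) / 2) ^ 2 = (1 + ρ i) / 2 := fun i =>
    Real.sq_sqrt (by linarith [(hρ i).1])
  have hρb : ∀ i, √((1 - ρ i) / 2) ^ 2 = (1 - ρ i) / 2 := fun i =>
    Real.sq_sqrt (by linarith [(hρ i).2])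
  refine ⟨inferInstance, mean (.fst ℝ _ _), mean ((ContinuousLinearMap.fst ℝ _ _).comp (.snd ℝ _ _)),
    mean ((ContinuousLinearMap.snd ℝ _ _).comp (.snd ℝ _ _)), ?_, ?_, ?_, ?_, ?_, ?_⟩
  · ext i j
    rw [crossCov, Matrix.of_apply, cov (by fun_prop) (by fun_prop)]
    by_cases hi : (i : ℕ) < min dX dY <;> by_cases hj : (j : ℕ) < min dX dY
    · rw [hX i hi, hX j hj, covariance_two_coord]
      rcases eq_or_ne i j with rfl | hij
      · have ha := hρa ⟨i, hi⟩
        have hb := hρb ⟨i, hi⟩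
        generalize √((1 + ρ ⟨i, hi⟩) / 2) = a at ha ⊢
        generalize √((1 - ρ ⟨i, hi⟩) / 2) = b at hb ⊢
        simp
        linear_combination ha + hb
      · have : (i : ℕ) ≠ j := fun h => hij (Fin.ext h)
        simp [hij, this]
    · rw [hX i hi, hX' j hj, covariance_two_coord]
      have hij : i ≠ j := fun h => hj (h ▸ hi)
      simp [hij]
    · rw [hX' i hi, hX j hj, covariance_two_coord]
      have hij : i ≠ j := fun h => hi (h ▸ hj)
      simp [hij]
    · rw [hX' i hi, hX' j hj, covariance_two_coord]
      simp [Matrix.one_apply]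
  · ext i j
    rw [crossCov, Matrix.of_apply, cov (by fun_prop) (by fun_prop)]
    by_cases hi : (i : ℕ) < min dX dY <;> by_cases hj : (j : ℕ) < min dX dY
    · rw [hY i hi, hY j hj, covariance_two_coord]
      rcases eq_or_ne i j with rfl | hij
      · have ha := hρa ⟨i, hi⟩
        have hb := hρb ⟨i, hi⟩
        generalize √((1 + ρ ⟨i, hi⟩) / 2) = a at ha ⊢
        generalize √((1 - ρ ⟨i, hi⟩) / 2) = b at hb ⊢
        simp
        linear_combination ha + hb
      · have : (i : ℕ) ≠ j := fun h => hij (Fin.ext h)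
        simp [hij, this]
    · rw [hY i hi, hY' j hj, covariance_two_coord]
      have hij : i ≠ j := fun h => hj (h ▸ hi)
      simp [hij]
    · rw [hY' i hi, hY j hj, covariance_two_coord]
      have hij : i ≠ j := fun h => hi (h ▸ hj)
      simp [hij]
    · rw [hY' i hi, hY' j hj, covariance_two_coord]
      simp [Matrix.one_apply]
  · ext i j
    rw [crossCov, Matrix.of_apply, cov (by fun_prop) (by fun_prop), hZ, hZ, covariance_two_coord]
    simp [Matrix.one_apply]
  · ext i k
    rw [crossCov, Matrix.of_apply, cov (by fun_prop) (by fun_prop), hZ]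
    by_cases hi : (i : ℕ) < min dX dY
    · rw [hX i hi, covariance_two_coord]; simp
    · rw [hX' i hi, covariance_two_coord]; simp
  · ext j k
    rw [crossCov, Matrix.of_apply, cov (by fun_prop) (by fun_prop), hZ]
    by_cases hj : (j : ℕ) < min dX dY
    · rw [hY j hj, covariance_two_coord]; simp
    · rw [hY' j hj, covariance_two_coord]; simp
  · ext i j
    rw [crossCov, Matrix.of_apply, cov (by fun_prop) (by fun_prop), rectDiagonal, Matrix.of_apply]
    by_cases hij : (i : ℕ) = j
    · have hi : (i : ℕ) < min dX dY := lt_min i.isLt (hij ▸ j.isLt)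
      have hj : (j : ℕ) < min dX dY := hij ▸ hi
      rw [dif_pos hij, hX i hi, hY j hj, covariance_two_coord]
      have e : ρ ⟨j, hj⟩ = ρ ⟨i, hi⟩ := by congr 2; exact hij.symm
      rw [e]
      have ha := hρa ⟨i, hi⟩
      have hb := hρb ⟨i, hi⟩
      generalize √((1 + ρ ⟨i, hi⟩) / 2) = a at ha ⊢
      generalize √((1 - ρ ⟨i, hi⟩) / 2) = b at hb ⊢
      generalize ρ ⟨i, hi⟩ = s at ha hb ⊢
      simp only [Sum.inl.injEq, Fin.ext_iff, hij, reduceCtorEq, if_true, if_false]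
      linear_combination ha - hb
    · rw [dif_neg hij]
      by_cases hi : (i : ℕ) < min dX dY <;> by_cases hj : (j : ℕ) < min dX dY
      · rw [hX i hi, hY j hj, covariance_two_coord]; simp [Fin.ext_iff, hij]
      · rw [hX i hi, hY' j hj, covariance_two_coord]; simp [Fin.ext_iff, hij]
      · rw [hX' i hi, hY j hj, covariance_two_coord]; simp [Fin.ext_iff, hij]
      · rw [hX' i hi, hY' j hj, covariance_two_coord]; simp

/-! ### Null laws obtained by confounding -/

/-- A finite sequence, padded by zeros or cut off at length `m`. -/
def extendZero {α : Type*} [Zero α] {r m : ℕ} (f : Fin r → α) (i : Fin m) : α :=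
  if h : (i : ℕ) < r then f ⟨i, h⟩ else 0

lemma extendZero_of_lt {α : Type*} [Zero α] {r m : ℕ} (f : Fin r → α) {i : Fin m}
    (h : (i : ℕ) < r) : extendZero f i = f ⟨i, h⟩ := dif_pos h

lemma extendZero_of_not_lt {α : Type*} [Zero α] {r m : ℕ} (f : Fin r → α) {i : Fin m}
    (h : ¬ (i : ℕ) < r) : extendZero f i = 0 := dif_neg h

lemma extendZero_mem_Ico {r m : ℕ} {f : Fin r → ℝ} (hf : ∀ i, f i ∈ Set.Ico (0 : ℝ) 1)
    (i : Fin m) : extendZero f i ∈ Set.Ico (0 : ℝ) 1 := by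
  unfold extendZero
  split_ifs with h
  · exact hf _
  · simp

/-- Independent vectors `X` and `Y` made dependent through the linear functionals `⟨a i, Z⟩`. -/
noncomputable def confound (ρ : Fin (min dX dY) → ℝ)
    (a : Fin (min dX dY) → EuclideanSpace ℝ (Fin dZ)) : Obs dX dY dZ →L[ℝ] Obs dX dY dZ :=
  LinearMap.toContinuousLinearMap
    { toFun := fun w =>
        (WithLp.toLp 2 fun i => √(extendZero ρ i) * inner ℝ (extendZero a i) w.2.2 +
            √(1 - extendZero ρ i) * w.1 i,
        WithLp.toLp 2 fun j => √(extendZero ρ j) * inner ℝ (extendZero a j) w.2.2 +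
            √(1 - extendZero ρ j) * w.2.1 j,
        w.2.2)
      map_add' := fun v w => by
        refine Prod.ext (PiLp.ext fun i => ?_) (Prod.ext (PiLp.ext fun j => ?_) rfl) <;>
          simp only [Prod.fst_add, Prod.snd_add, PiLp.add_apply, inner_add_right] <;> ring
      map_smul' := fun c w => by
        refine Prod.ext (PiLp.ext fun i => ?_) (Prod.ext (PiLp.ext fun j => ?_) rfl) <;>
          simp only [Prod.smul_fst, Prod.smul_snd, PiLp.smul_apply, inner_smul_right, smul_eq_mul,
            RingHom.id_apply] <;> ring }

section
variable (ρ : Fin (min dX dY) → ℝ) (a : Fin (min dX dY) → EuclideanSpace ℝ (Fin dZ))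

lemma confound_fst (w : Obs dX dY dZ) (i : Fin dX) :
    (confound ρ a w).1 i = √(extendZero ρ i) * inner ℝ (extendZero a i) w.2.2 +
      √(1 - extendZero ρ i) * w.1 i := rfl

lemma confound_snd_fst (w : Obs dX dY dZ) (j : Fin dY) :
    (confound ρ a w).2.1 j = √(extendZero ρ j) * inner ℝ (extendZero a j) w.2.2 +
      √(1 - extendZero ρ j) * w.2.1 j := rfl

/-- As `ρ i < 1`, every noise coefficient is nonzero and the noises can be solved for. This yields
the injective covariance operator demanded of a null law. -/
lemma confound_surjective {ρ : Fin (min dX dY) → ℝ} (hρ : ∀ i, ρ i ∈ Set.Ico (0 : ℝ) 1) :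
    Function.Surjective (confound ρ a) := by
  have hs : ∀ {m : ℕ} (i : Fin m), √(1 - extendZero ρ i) ≠ 0 := fun i =>
    (Real.sqrt_pos.2 (by linarith [(extendZero_mem_Ico hρ i).2])).ne'
  intro w
  refine ⟨(WithLp.toLp 2 fun i => (√(1 - extendZero ρ i))⁻¹ *
      (w.1 i - √(extendZero ρ i) * inner ℝ (extendZero a i) w.2.2),
    WithLp.toLp 2 fun j => (√(1 - extendZero ρ j))⁻¹ *
      (w.2.1 j - √(extendZero ρ j) * inner ℝ (extendZero a j) w.2.2), w.2.2), ?_⟩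
  refine Prod.ext (PiLp.ext fun i => ?_) (Prod.ext (PiLp.ext fun j => ?_) rfl)
  · rw [confound_fst]; simp only; rw [mul_inv_cancel_left₀ (hs i)]; ring
  · rw [confound_snd_fst]; simp only; rw [mul_inv_cancel_left₀ (hs j)]; ring

end

lemma variance_sum_coord (c : Fin dX ⊕ Fin dY ⊕ Fin dZ → ℝ) :
    Var[fun w => ∑ k, c k * coord k w; stdLaw dX dY dZ] = ∑ k, c k ^ 2 := by
  have hm : ∀ k, MemLp (fun w => c k * coord k w) 2 (stdLaw dX dY dZ) :=
    fun k => (memLp_coord _ k).const_mul _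
  have hc : ∀ k l, cov[fun w => coord k w, fun w => coord l w; stdLaw dX dY dZ] =
      if k = l then 1 else 0 := fun k l => by
    rw [← standardCov_zero]; exact isStandardLaw_stdLaw.covariance_coord k l
  rw [← covariance_self (memLp_finsetSum _ fun k _ => hm k).aemeasurable,
    covariance_fun_sum_fun_sum hm hm]
  simp_rw [covariance_const_mul_left, covariance_const_mul_right, hc]
  simp [sq]

/-- A functional `L` in the kernel of the covariance has variance zero. That variance is the sum of
the squared coefficients of `L ∘ T`, so `L` vanishes on the range of `T`. -/
lemma isModelLaw_map_stdLaw {T : Obs dX dY dZ →L[ℝ] Obs dX dY dZ} (hT : Function.Surjective T) :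
    IsModelLaw ((stdLaw dX dY dZ).map T) := by
  refine ⟨inferInstance, (injective_iff_map_eq_zero _).2 fun L hL => ?_⟩
  have hvar : Var[L; (stdLaw dX dY dZ).map T] = 0 := by
    rw [← covarianceBilinDual_self_eq_variance IsGaussian.memLp_two_id, hL]; rfl
  rw [variance_map (by fun_prop) (by fun_prop)] at hvar
  obtain ⟨c, hc⟩ := exists_eq_sum_coord (L.comp T)
  have hLT : (L : Obs dX dY dZ → ℝ) ∘ T = fun w => ∑ k, c k * coord k w := funext hc
  rw [hLT, variance_sum_coord,
    Finset.sum_eq_zero_iff_of_nonneg fun k _ => sq_nonneg _] at hvar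
  refine ContinuousLinearMap.ext fun w => ?_
  obtain ⟨v, rfl⟩ := hT w
  have := hc v
  simp only [ContinuousLinearMap.comp_apply] at this
  rw [this]
  simp only [zero_apply]
  exact Finset.sum_eq_zero fun k hk => by rw [pow_eq_zero_iff two_ne_zero |>.1 (hvar k hk), zero_mul]

/-- If `X`, `Y` are functions of independent noises and of `Z`, then they are conditionally
independent given `Z`. -/
lemma condIndepFun_map_prod {A B C A' B' : Type*} [MeasurableSpace A] [MeasurableSpace B]
    [MeasurableSpace C] [MeasurableSpace A'] [MeasurableSpace B']
    [StandardBorelSpace (A' × B' × C)]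
    (μ : Measure A) (ν : Measure B) (κ : Measure C) [IsProbabilityMeasure μ]
    [IsProbabilityMeasure ν] [IsProbabilityMeasure κ] {f : A → C → A'} {g : B → C → B'}
    (hf : Measurable (Function.uncurry f)) (hg : Measurable (Function.uncurry g))
    (hm : MeasurableSpace.comap (fun w : A' × B' × C => w.2.2) inferInstance ≤
      (inferInstance : MeasurableSpace (A' × B' × C))) {P : Measure (A' × B' × C)}
    [IsFiniteMeasure P]
    (hP : P = (μ.prod (ν.prod κ)).map fun w => (f w.1 w.2.2, g w.2.1 w.2.2, w.2.2)) :
    CondIndepFun (MeasurableSpace.comap (fun w : A' × B' × C => w.2.2) inferInstance) hm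
      (fun w => w.1) (fun w => w.2.1) P := by
  have hT : Measurable fun w : A × B × C => (f w.1 w.2.2, g w.2.1 w.2.2, w.2.2) := by
    refine Measurable.prodMk ?_ (Measurable.prodMk ?_ (by fun_prop))
    · exact hf.comp (by fun_prop : Measurable fun w : A × B × C => (w.1, w.2.2))
    · exact hg.comp (by fun_prop : Measurable fun w : A × B × C => (w.2.1, w.2.2))
  have hgz : ∀ z, Measurable fun y => g y z := fun z =>
    hg.comp measurable_prodMk_right
  have hmf : ∀ {s : Set A'}, MeasurableSet s → Measurable fun z => μ {x | f x z ∈ s} :=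
    fun hs => measurable_measure_prodMk_right (hf hs)
  have hmg : ∀ {t : Set B'}, MeasurableSet t → Measurable fun z => ν {y | g y z ∈ t} :=
    fun ht => measurable_measure_prodMk_right (hg ht)
  -- Given `Z = z` the noises keep their independent laws, so a rectangle has conditional
  -- probability equal to the product of the two noise probabilities at `z`.
  have key : ∀ s t, MeasurableSet s → MeasurableSet t →
      (fun w : A' × B' × C => (μ {x | f x w.2.2 ∈ s} * ν {y | g y w.2.2 ∈ t}).toReal) =ᵐ[P]
        P⟦(fun w => w.1) ⁻¹' s ∩ (fun w => w.2.1) ⁻¹' t |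
          MeasurableSpace.comap (fun w : A' × B' × C => w.2.2) inferInstance⟧ := by
    intro s t hs ht
    have hfin : ∀ z, μ {x | f x z ∈ s} * ν {y | g y z ∈ t} ≤ 1 := fun z =>
      (mul_le_mul' prob_le_one prob_le_one).trans_eq (one_mul 1)
    have hst : MeasurableSet ((fun w : A' × B' × C => w.1) ⁻¹' s ∩ (fun w => w.2.1) ⁻¹' t) :=
      (measurable_fst hs).inter (measurable_snd.fst ht)
    have hmeas : Measurable fun z => μ {x | f x z ∈ s} * ν {y | g y z ∈ t} :=
      (hmf hs).mul (hmg ht)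
    have hcomp : Measurable fun w : A' × B' × C =>
        μ {x | f x w.2.2 ∈ s} * ν {y | g y w.2.2 ∈ t} := hmeas.comp measurable_snd.snd
    have hint : Integrable (fun w : A' × B' × C =>
        (μ {x | f x w.2.2 ∈ s} * ν {y | g y w.2.2 ∈ t}).toReal) P := by
      refine Integrable.of_bound hcomp.ennreal_toReal.aestronglyMeasurable 1 (.of_forall fun w => ?_)
      rw [Real.norm_eq_abs, abs_of_nonneg ENNReal.toReal_nonneg]
      exact ENNReal.toReal_le_of_le_ofReal zero_le_one (by simpa using hfin _)
    refine ae_eq_condExp_of_forall_setIntegral_eq hm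
      ((integrable_const _).indicator hst) (fun _ _ _ => hint.integrableOn) ?_ ?_
    -- Every event of the conditioning σ-algebra has the form `Z ∈ D`; on it the two integrals are
    -- compared by integrating out the noises at fixed `z`.
    · rintro _ ⟨D, hD, rfl⟩ -
      have hD' : MeasurableSet ((fun w : A' × B' × C => w.2.2) ⁻¹' D) := measurable_snd.snd hD
      rw [integral_indicator hst, Measure.restrict_restrict hst, setIntegral_const, smul_eq_mul,
        mul_one, integral_toReal hcomp.aemeasurable
          (.of_forall fun w => (hfin _).trans_lt ENNReal.one_lt_top), measureReal_def]
      congr 1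
      rw [← lintegral_indicator hD', hP, lintegral_map 
        (hcomp.indicator hD') hT,
        Measure.map_apply hT (hst.inter hD')]
      have hind : Measurable (D.indicator fun z => μ {x | f x z ∈ s} * ν {y | g y z ∈ t}) :=
        hmeas.indicator hD
      have hl : ∫⁻ w : A × B × C, D.indicator (fun z => μ {x | f x z ∈ s} * ν {y | g y z ∈ t}) w.2.2
          ∂μ.prod (ν.prod κ) = ∫⁻ z, D.indicator (fun z => μ {x | f x z ∈ s} * ν {y | g y z ∈ t}) z
            ∂κ := by
        have hp : MeasurePreserving (fun w : A × B × C => w.2.2) (μ.prod (ν.prod κ)) κ :=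
          measurePreserving_snd.comp measurePreserving_snd
        exact hp.lintegral_comp hind
      refine Eq.trans hl ?_
      have hE := hT (hst.inter hD')
      rw [Measure.prod_apply_symm hE, lintegral_prod_symm _
        (measurable_measure_prodMk_right hE).aemeasurable]
      refine lintegral_congr fun z => ?_
      by_cases hz : z ∈ D
      · have hy : ∀ y, μ ((fun x => (x, y, z)) ⁻¹'
            ((fun w : A × B × C => (f w.1 w.2.2, g w.2.1 w.2.2, w.2.2)) ⁻¹'
              (((fun w : A' × B' × C => w.1) ⁻¹' s ∩ (fun w => w.2.1) ⁻¹' t) ∩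
                (fun w => w.2.2) ⁻¹' D))) =
            {y | g y z ∈ t}.indicator (fun _ => μ {x | f x z ∈ s}) y := by
          intro y
          by_cases hy : g y z ∈ t
          · rw [Set.indicator_of_mem (by exact hy)]
            congr 1
            ext x
            simp [hy, hz]
          · rw [Set.indicator_of_notMem (by exact hy)]
            convert measure_empty (μ := μ)
            ext x
            simp [hy]
        simp_rw [hy]
        rw [Set.indicator_of_mem hz]
        exact (lintegral_indicator_const (hgz z ht) _).symm
      · rw [Set.indicator_of_notMem hz]
        symm
        convert lintegral_zero (μ := ν) with y
        convert measure_empty (μ := μ)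
        ext x
        simp [hz]
    · refine Measurable.aestronglyMeasurable ?_
      exact (hmeas.ennreal_toReal).comp (comap_measurable _)
  rw [condIndepFun_iff_condExp_inter_preimage_eq_mul measurable_fst measurable_snd.fst]
  intro s t hs ht
  have h₁ := key s t hs ht
  -- Taking one side of the rectangle to be everything gives the two conditional marginals.
  have h₂ := key s .univ hs .univ
  have h₃ := key .univ t .univ ht
  simp only [Set.preimage_univ, Set.inter_univ, Set.univ_inter] at h₂ h₃
  filter_upwards [h₁, h₂, h₃] with w e₁ e₂ e₃
  rw [← e₁, ← e₂, ← e₃]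
  simp

lemma isNullLaw_confound {ρ : Fin (min dX dY) → ℝ} (hρ : ∀ i, ρ i ∈ Set.Ico (0 : ℝ) 1)
    (a : Fin (min dX dY) → EuclideanSpace ℝ (Fin dZ)) :
    IsNullLaw ((stdLaw dX dY dZ).map (confound ρ a)) := by
  refine ⟨isModelLaw_map_stdLaw (confound_surjective a hρ), inferInstance, ?_⟩
  refine condIndepFun_map_prod _ _ _ (f := fun (x : EuclideanSpace ℝ (Fin dX)) (z : EuclideanSpace ℝ (Fin dZ)) => WithLp.toLp 2 fun i =>
      √(extendZero ρ i) * inner ℝ (extendZero a i) z + √(1 - extendZero ρ i) * x i)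
    (g := fun (y : EuclideanSpace ℝ (Fin dY)) (z : EuclideanSpace ℝ (Fin dZ)) => WithLp.toLp 2 fun j =>
      √(extendZero ρ j) * inner ℝ (extendZero a j) z + √(1 - extendZero ρ j) * y j) ?_ ?_ _ rfl
  · unfold Function.uncurry; fun_prop
  · unfold Function.uncurry; fun_prop

lemma map_snd_snd_confound (ρ : Fin (min dX dY) → ℝ)
    (a : Fin (min dX dY) → EuclideanSpace ℝ (Fin dZ)) :
    ((stdLaw dX dY dZ).map (confound ρ a)).map (fun w => w.2.2) =
      (stdLaw dX dY dZ).map (fun w => w.2.2) := by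
  rw [Measure.map_map (by fun_prop) (by fun_prop)]
  rfl

lemma map_snd_snd_correlate (ρ : Fin (min dX dY) → ℝ) :
    ((stdLaw dX dY dZ).map (correlate dZ ρ)).map (fun w => w.2.2) =
      (stdLaw dX dY dZ).map (fun w => w.2.2) := by
  rw [Measure.map_map (by fun_prop) (by fun_prop)]
  rfl

/-! ### The density of a confounded law -/

/-- Replaces the coordinates of `X` by correlated copies of the functionals `⟨a i, Z⟩`. -/
noncomputable def shear (t : Fin dX → ℝ) (a : Fin dX → EuclideanSpace ℝ (Fin dZ))
    (w : Obs dX dY dZ) : Obs dX dY dZ :=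
  (WithLp.toLp 2 fun i => √(t i) * inner ℝ (a i) w.2.2 + √(1 - t i) * w.1 i, w.2)

@[fun_prop]
lemma measurable_shear (t : Fin dX → ℝ) (a : Fin dX → EuclideanSpace ℝ (Fin dZ)) :
    Measurable (shear (dY := dY) t a) := by
  unfold shear; fun_prop

/-- The density of the law of `shear t a` with respect to `stdLaw`. -/
noncomputable def shearDensity (t : Fin dX → ℝ) (a : Fin dX → EuclideanSpace ℝ (Fin dZ))
    (w : Obs dX dY dZ) : ℝ :=
  ∏ i, shiftDensity (t i) (inner ℝ (a i) w.2.2) (w.1 i)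

lemma shearDensity_nonneg (t : Fin dX → ℝ) (a : Fin dX → EuclideanSpace ℝ (Fin dZ))
    (w : Obs dX dY dZ) : 0 ≤ shearDensity t a w :=
  Finset.prod_nonneg fun _ _ => shiftDensity_nonneg _ _ _

@[fun_prop]
lemma measurable_shearDensity (t : Fin dX → ℝ) (a : Fin dX → EuclideanSpace ℝ (Fin dZ)) :
    Measurable (shearDensity (dY := dY) t a) := by
  unfold shearDensity; fun_prop

lemma lintegral_stdGaussian {n : ℕ} {f : EuclideanSpace ℝ (Fin n) → ℝ≥0∞} (hf : Measurable f) :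
    ∫⁻ x, f x ∂stdGaussian (EuclideanSpace ℝ (Fin n)) =
      ∫⁻ x, f (WithLp.toLp 2 x) ∂Measure.pi fun _ => gaussianReal 0 1 := by
  rw [← map_pi_eq_stdGaussian, lintegral_map hf (by fun_prop)]

/-- The map acts on each coordinate separately, so this is the product of the one-dimensional
statements `map_shift_gaussianReal`. -/
lemma lintegral_shift {n : ℕ} {t : Fin n → ℝ} (ht1 : ∀ i, t i < 1) (m : Fin n → ℝ)
    {f : EuclideanSpace ℝ (Fin n) → ℝ≥0∞} (hf : Measurable f) :
    ∫⁻ x, f (WithLp.toLp 2 fun i => √(t i) * m i + √(1 - t i) * x i)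
        ∂stdGaussian (EuclideanSpace ℝ (Fin n)) =
      ∫⁻ x, ENNReal.ofReal (∏ i, shiftDensity (t i) (m i) (x i)) * f x
        ∂stdGaussian (EuclideanSpace ℝ (Fin n)) := by
  have hpi : (Measure.pi fun _ : Fin n => gaussianReal 0 1).map
      (fun x i => √(t i) * m i + √(1 - t i) * x i) =
      (Measure.pi fun _ : Fin n => gaussianReal 0 1).withDensity
        fun x => ∏ i, ENNReal.ofReal (shiftDensity (t i) (m i) (x i)) := by
    have hprob : ∀ i, IsProbabilityMeasure ((gaussianReal 0 1).withDensity
        fun u => ENNReal.ofReal (shiftDensity (t i) (m i) u)) := fun i => by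
      rw [← map_shift_gaussianReal (ht1 i)]
      exact Measure.isProbabilityMeasure_map (by fun_prop)
    rw [← pi_withDensity (fun _ : Fin n => gaussianReal 0 1)
      (f := fun i u => ENNReal.ofReal (shiftDensity (t i) (m i) u)) (fun i => by fun_prop)]
    have : ∀ i, SigmaFinite ((gaussianReal 0 1).map fun u => √(t i) * m i + √(1 - t i) * u) :=
      fun i => by
        have := Measure.isProbabilityMeasure_map (μ := gaussianReal 0 1)
          (f := fun u => √(t i) * m i + √(1 - t i) * u) (by fun_prop)
        infer_instance
    rw [Measure.pi_map_pi (μ := fun _ : Fin n => gaussianReal 0 1)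
      (f := fun i u => √(t i) * m i + √(1 - t i) * u) (fun i => by fun_prop)]
    simp_rw [map_shift_gaussianReal (ht1 _)]
  have h0 : Measurable fun x : EuclideanSpace ℝ (Fin n) =>
      f (WithLp.toLp 2 fun i => √(t i) * m i + √(1 - t i) * x i) := hf.comp (by fun_prop)
  rw [lintegral_stdGaussian h0, lintegral_stdGaussian (by fun_prop)]
  have hf' : Measurable fun x : Fin n → ℝ => f (WithLp.toLp 2 x) := hf.comp (by fun_prop)
  have h1 := lintegral_map (μ := Measure.pi fun _ : Fin n => gaussianReal 0 1)
    (f := fun x => f (WithLp.toLp 2 x)) (g := fun x i => √(t i) * m i + √(1 - t i) * x i)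
    hf' (by fun_prop)
  rw [hpi, lintegral_withDensity_eq_lintegral_mul _ (by fun_prop) hf'] at h1
  simp only
  rw [← h1]
  refine lintegral_congr fun x => ?_
  rw [Pi.mul_apply, ENNReal.ofReal_prod_of_nonneg fun i _ => shiftDensity_nonneg _ _ _]

/-- For fixed `Y` and `Z` the shear is a coordinatewise affine map of `X`, to which
`lintegral_shift` applies. -/
lemma lintegral_shear {t : Fin dX → ℝ} (ht1 : ∀ i, t i < 1)
    (a : Fin dX → EuclideanSpace ℝ (Fin dZ)) {f : Obs dX dY dZ → ℝ≥0∞} (hf : Measurable f) :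
    ∫⁻ w, f (shear t a w) ∂stdLaw dX dY dZ =
      ∫⁻ w, ENNReal.ofReal (shearDensity t a w) * f w ∂stdLaw dX dY dZ := by
  have h0 : Measurable fun w => f (shear t a w) := hf.comp (by fun_prop)
  have h1 : Measurable fun w => ENNReal.ofReal (shearDensity t a w) * f w := by fun_prop
  rw [stdLaw, lintegral_prod_symm' _ h0]
  refine Eq.trans ?_ (lintegral_prod_symm' _ h1).symm
  refine lintegral_congr fun v => ?_
  exact lintegral_shift ht1 (fun i => inner ℝ (a i) v.2) (f := fun x => f (x, v))
    (hf.comp (by fun_prop))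

lemma map_shear {t : Fin dX → ℝ} (ht1 : ∀ i, t i < 1) (a : Fin dX → EuclideanSpace ℝ (Fin dZ)) :
    (stdLaw dX dY dZ).map (shear t a) =
      (stdLaw dX dY dZ).withDensity fun w => ENNReal.ofReal (shearDensity t a w) := by
  refine Measure.ext_of_lintegral _ fun f hf => ?_
  rw [lintegral_map hf (by fun_prop), lintegral_shear ht1 a hf,
    lintegral_withDensity_eq_lintegral_mul _ (by fun_prop) hf]
  rfl

/-- The fraction of the variance of a principal component of `(X i, Y i)` explained by `Z`. -/
noncomputable def explained (s : ℝ) : ℝ := 2 * s / (1 + s)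

@[simp] lemma explained_zero : explained 0 = 0 := by simp [explained]

lemma explained_mem_Ico {s : ℝ} (hs : s ∈ Set.Ico (0 : ℝ) 1) :
    explained s ∈ Set.Ico (0 : ℝ) 1 := by
  obtain ⟨h0, h1⟩ := hs
  unfold explained
  refine ⟨by positivity, ?_⟩
  rw [div_lt_one (by linarith)]
  linarith

lemma sqrt_mul_sqrt_explained {s : ℝ} (hs : s ∈ Set.Ico (0 : ℝ) 1) :
    √((1 + s) / 2) * √(explained s) = √s := by
  obtain ⟨h0, h1⟩ := hs
  rw [← Real.sqrt_mul (by linarith)]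
  congr 1
  unfold explained
  field_simp

lemma sqrt_mul_sqrt_one_sub_explained {s : ℝ} (hs : s ∈ Set.Ico (0 : ℝ) 1) :
    √((1 + s) / 2) * √(1 - explained s) = √((1 - s) / 2) := by
  obtain ⟨h0, h1⟩ := hs
  rw [← Real.sqrt_mul (by linarith)]
  congr 1
  unfold explained
  field_simp
  ring

/-- Up to normalisation `correlate dZ 0` replaces the noises of `X i` and `Y i` by their sum and
difference. As `Z` enters both coordinates equally, it can be absorbed into the sum component alone,
before `correlate dZ ρ` is applied. The value of `explained` is the one that makes the coefficients
match. -/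
lemma confound_correlate_zero {ρ : Fin (min dX dY) → ℝ} (hρ : ∀ i, ρ i ∈ Set.Ico (0 : ℝ) 1)
    (a : Fin (min dX dY) → EuclideanSpace ℝ (Fin dZ)) (w : Obs dX dY dZ) :
    confound ρ a (correlate dZ 0 w) =
      correlate dZ ρ (shear (fun i => explained (extendZero ρ i)) (fun i => extendZero a i) w) := by
  have hs : ∀ s ∈ Set.Ico (0 : ℝ) 1, √(1 - s) * √(1 / 2) = √((1 - s) / 2) := fun s hs => by
    rw [← Real.sqrt_mul (by linarith [hs.2])]; congr 1; ring
  refine Prod.ext (PiLp.ext fun i => ?_) (Prod.ext (PiLp.ext fun j => ?_) rfl)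
  · rw [confound_fst, correlate_fst, correlate_fst]
    by_cases h : (i : ℕ) < min dX dY
    · simp only [dif_pos h, shear, correlate_snd_snd, extendZero_of_lt _ h, Pi.zero_apply,
        add_zero, sub_zero]
      have h1 := sqrt_mul_sqrt_explained (hρ ⟨i, h⟩)
      have h2 := sqrt_mul_sqrt_one_sub_explained (hρ ⟨i, h⟩)
      have h3 := hs _ (hρ ⟨i, h⟩)
      linear_combination (-inner ℝ (a ⟨i, h⟩) w.2.2) * h1 - w.1 i * h2 +
        (w.1 i + w.2.1 ⟨i, h.trans_le (min_le_right _ _)⟩) * h3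
    · simp [dif_neg h, shear, extendZero_of_not_lt _ h, -lt_inf_iff]
  · rw [confound_snd_fst, correlate_snd_fst, correlate_snd_fst]
    by_cases h : (j : ℕ) < min dX dY
    · have h' : ((⟨j, h.trans_le (min_le_left _ _)⟩ : Fin dX) : ℕ) < min dX dY := h
      simp only [dif_pos h, shear, correlate_snd_snd, extendZero_of_lt _ h, extendZero_of_lt _ h',
        Pi.zero_apply, add_zero, sub_zero]
      have h1 := sqrt_mul_sqrt_explained (hρ ⟨j, h⟩)
      have h2 := sqrt_mul_sqrt_one_sub_explained (hρ ⟨j, h⟩)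
      have h3 := hs _ (hρ ⟨j, h⟩)
      linear_combination (-inner ℝ (a ⟨j, h⟩) w.2.2) * h1 -
        w.1 ⟨j, h.trans_le (min_le_left _ _)⟩ * h2 +
        (w.1 ⟨j, h.trans_le (min_le_left _ _)⟩ - w.2.1 j) * h3
    · simp [dif_neg h, shear, extendZero_of_not_lt _ h, -lt_inf_iff]

/-- The null law and `Q` are images under the same map `correlate dZ ρ` of `stdLaw` with and without
a density, so tests can be pulled back to `stdLaw` and compared there. -/
lemma map_confound_eq {ρ : Fin (min dX dY) → ℝ} (hρ : ∀ i, ρ i ∈ Set.Ico (0 : ℝ) 1)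
    (a : Fin (min dX dY) → EuclideanSpace ℝ (Fin dZ)) :
    (stdLaw dX dY dZ).map (confound ρ a) =
      ((stdLaw dX dY dZ).withDensity fun w => ENNReal.ofReal
        (shearDensity (fun i => explained (extendZero ρ i)) (fun i => extendZero a i) w)).map
          (correlate dZ ρ) := by
  -- With zero correlations the image is again a standard law, so uniqueness shows that `stdLaw` is
  -- invariant.
  have h0 : (stdLaw dX dY dZ).map (correlate dZ 0) = stdLaw dX dY dZ :=
    (isStandardLaw_correlate fun _ => by simp).unique isStandardLaw_stdLaw
  rw [← map_shear fun i => (explained_mem_Ico (extendZero_mem_Ico hρ i)).2,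
    Measure.map_map (by fun_prop) (by fun_prop)]
  conv_lhs => rw [← h0]
  rw [Measure.map_map (by fun_prop) (by fun_prop)]
  congr 1
  ext1 w
  exact confound_correlate_zero hρ a w

/-! ### Second moments of the densities -/

/-- Orthogonal directions give jointly Gaussian uncorrelated, hence independent, functionals. The
vectors need not be normalised and may be zero. -/
lemma lintegral_prod_inner_stdGaussian {κ : Type*} [Fintype κ] {n : ℕ}
    {b : κ → EuclideanSpace ℝ (Fin n)} (hb : ∀ k l, k ≠ l → inner ℝ (b k) (b l) = 0)
    {F : κ → ℝ → ℝ≥0∞} (hF : ∀ k, Measurable (F k)) :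
    ∫⁻ z, ∏ k, F k (inner ℝ (b k) z) ∂stdGaussian (EuclideanSpace ℝ (Fin n)) =
      ∏ k, ∫⁻ x, F k x ∂gaussianReal 0 (inner ℝ (b k) (b k)).toNNReal := by
  have hcov : ∀ k l, cov[fun z => inner ℝ (b k) z, fun z => inner ℝ (b l) z;
      stdGaussian (EuclideanSpace ℝ (Fin n))] = inner ℝ (b k) (b l) := fun k l => by
    rw [← covarianceBilin_apply_eq_cov IsGaussian.memLp_two_id, covarianceBilin_stdGaussian,
      innerSL_apply_apply]
  have hlaw : HasGaussianLaw (fun z k => inner ℝ (b k) z)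
      (stdGaussian (EuclideanSpace ℝ (Fin n))) :=
    IsGaussian.hasGaussianLaw_id.map (ContinuousLinearMap.pi fun k => innerSL ℝ (b k))
  have hind : iIndepFun (fun k z => inner ℝ (b k) z) (stdGaussian (EuclideanSpace ℝ (Fin n))) :=
    hlaw.iIndepFun_of_covariance_eq_zero fun k l hkl => by rw [hcov, hb k l hkl]
  have hprod := lintegral_prod_eq_prod_lintegral_of_indepFun Finset.univ
    (fun k z => F k (inner ℝ (b k) z)) (hind.comp F hF) (fun k => by fun_prop)
  rw [hprod]
  refine Finset.prod_congr rfl fun k _ => ?_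
  have hmap : (stdGaussian (EuclideanSpace ℝ (Fin n))).map (fun z => inner ℝ (b k) z) =
      gaussianReal 0 (inner ℝ (b k) (b k)).toNNReal := by
    have h := IsGaussian.map_eq_gaussianReal (μ := stdGaussian (EuclideanSpace ℝ (Fin n)))
      (innerSL ℝ (b k))
    rw [integral_strongDual_stdGaussian, ← covariance_self (by fun_prop)] at h
    rw [← hcov k k]
    exact h
  rw [← hmap, lintegral_map (hF k) (by fun_prop)]

lemma prod_extend {M : Type*} [CommMonoid M] {r m : ℕ} (h : r ≤ m) (f : Fin m → M) (g : Fin r → M)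
    (hf : ∀ (i : Fin m) (hi : (i : ℕ) < r), f i = g ⟨i, hi⟩)
    (hf' : ∀ i : Fin m, ¬ (i : ℕ) < r → f i = 1) : ∏ i, f i = ∏ i, g i := by
  rw [← Finset.prod_subset (Finset.subset_univ (Finset.univ.map (Fin.castLEEmb h)))
    fun i _ hi => hf' i fun hlt => hi (by simpa using ⟨⟨i, hlt⟩, rfl⟩), Finset.prod_map]
  exact Finset.prod_congr rfl fun i _ => hf _ i.isLt

lemma lintegral_prod_shiftDensity {n : ℕ} {t : Fin n → ℝ} (ht : ∀ i, t i ∈ Set.Ico (0 : ℝ) 1)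
    (p q : Fin n → ℝ) :
    ∫⁻ x, ENNReal.ofReal ((∏ i, shiftDensity (t i) (p i + q i) (x i)) *
        ∏ i, shiftDensity (t i) (p i - q i) (x i)) ∂stdGaussian (EuclideanSpace ℝ (Fin n)) =
      ∏ i, ENNReal.ofReal ((√(1 - t i ^ 2))⁻¹ * (Real.exp (t i / (1 + t i) * p i ^ 2) *
        Real.exp (-(t i / (1 - t i)) * q i ^ 2))) := by
  rw [lintegral_stdGaussian (by fun_prop)]
  simp_rw [← Finset.prod_mul_distrib]
  have h : ∀ x : Fin n → ℝ, ENNReal.ofReal (∏ i, shiftDensity (t i) (p i + q i) (x i) *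
      shiftDensity (t i) (p i - q i) (x i)) = ∏ i, ENNReal.ofReal
        (shiftDensity (t i) (p i + q i) (x i) * shiftDensity (t i) (p i - q i) (x i)) := fun x =>
    ENNReal.ofReal_prod_of_nonneg fun i _ =>
      mul_nonneg (shiftDensity_nonneg _ _ _) (shiftDensity_nonneg _ _ _)
  simp_rw [h]
  rw [lintegral_pi_prod (fun _ : Fin n => gaussianReal 0 1) (f := fun i u => ENNReal.ofReal
    (shiftDensity (t i) (p i + q i) u * shiftDensity (t i) (p i - q i) u)) fun i => by fun_prop]
  exact Finset.prod_congr rfl fun i _ =>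
    lintegral_shiftDensity_mul_shiftDensity (ht i).1 (ht i).2 (p i) (q i)

/-- For fixed `Z` the integral over `X` splits into factors depending on `⟨p i, Z⟩` and `⟨q i, Z⟩`,
the half sums and half differences of the two families. These `2 r` directions are mutually
orthogonal, so the integral over `Z` factors as well. -/
lemma lintegral_shearDensity_mul_shearDensity {r : ℕ} (hr : r ≤ dX) {t : Fin r → ℝ}
    (ht : ∀ i, t i ∈ Set.Ico (0 : ℝ) 1) {a a' : Fin r → EuclideanSpace ℝ (Fin dZ)} {c : Fin r → ℝ}
    (ha : ∀ i j, inner ℝ (a i) (a j) = if i = j then 1 else 0)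
    (ha' : ∀ i j, inner ℝ (a' i) (a' j) = if i = j then 1 else 0)
    (haa' : ∀ i j, inner ℝ (a i) (a' j) = if i = j then c i else 0) :
    ∫⁻ w, ENNReal.ofReal (shearDensity (extendZero t) (extendZero a) w *
        shearDensity (extendZero t) (extendZero a') w) ∂stdLaw dX dY dZ =
      ENNReal.ofReal (∏ i, (1 - c i * t i)⁻¹) := by
  have ha'a : ∀ i j, inner ℝ (a' i) (a j) = if i = j then c i else 0 := fun i j => by
    rw [real_inner_comm, haa']
    rcases eq_or_ne i j with rfl | h
    · rfl
    · rw [if_neg h, if_neg h.symm]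
  -- `p i` and `q i` are orthogonal because `a i` and `a' i` have equal norms; their squared norms
  -- are `(1 ± c i) / 2`.
  set p : Fin r → EuclideanSpace ℝ (Fin dZ) := fun i => (1 / 2 : ℝ) • (a i + a' i) with hp
  set q : Fin r → EuclideanSpace ℝ (Fin dZ) := fun i => (1 / 2 : ℝ) • (a i - a' i) with hq
  have hpp : ∀ i j, inner ℝ (p i) (p j) = if i = j then (1 + c i) / 2 else 0 := fun i j => by
    simp only [hp, inner_smul_left, inner_smul_right, inner_add_left, inner_add_right, ha, ha', haa',
      ha'a]
    split_ifs
    · simp; ring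
    · simp
  have hqq : ∀ i j, inner ℝ (q i) (q j) = if i = j then (1 - c i) / 2 else 0 := fun i j => by
    simp only [hq, inner_smul_left, inner_smul_right, inner_sub_left, inner_sub_right, ha, ha', haa',
      ha'a]
    split_ifs
    · simp; ring
    · simp
  have hpq : ∀ i j, inner ℝ (p i) (q j) = 0 := fun i j => by
    simp only [hp, hq, inner_smul_left, inner_smul_right, inner_add_left, inner_sub_right, ha, ha',
      haa', ha'a]
    split_ifs
    · simp; ring
    · simp
  have hap : ∀ i, a i = p i + q i := fun i => by simp only [hp, hq]; module
  have haq : ∀ i, a' i = p i - q i := fun i => by simp only [hp, hq]; module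
  have hx : ∀ v : EuclideanSpace ℝ (Fin dY) × EuclideanSpace ℝ (Fin dZ),
      ∫⁻ x, ENNReal.ofReal (shearDensity (extendZero t) (extendZero a) (x, v) *
        shearDensity (extendZero t) (extendZero a') (x, v))
          ∂stdGaussian (EuclideanSpace ℝ (Fin dX)) =
      (∏ i, ENNReal.ofReal (√(1 - t i ^ 2))⁻¹) * ∏ k : Fin r ⊕ Fin r,
        Sum.elim (fun i (y : ℝ) => ENNReal.ofReal (Real.exp (t i / (1 + t i) * y ^ 2)))
          (fun i (y : ℝ) => ENNReal.ofReal (Real.exp (-(t i / (1 - t i)) * y ^ 2))) k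
            (inner ℝ (Sum.elim p q k) v.2) := by
    intro v
    have e : ∀ i : Fin dX, (extendZero a i = extendZero p i + extendZero q i) ∧
        (extendZero a' i = extendZero p i - extendZero q i) := fun i => by
      by_cases h : (i : ℕ) < r
      · simp only [extendZero_of_lt _ h]; exact ⟨hap _, haq _⟩
      · simp [extendZero_of_not_lt _ h]
    unfold shearDensity
    simp only [(e _).1, (e _).2, inner_add_left, inner_sub_left]
    rw [lintegral_prod_shiftDensity fun i => extendZero_mem_Ico ht i, Fintype.prod_sum_type,
      ← Finset.prod_mul_distrib, ← Finset.prod_mul_distrib]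
    -- Indices beyond `r` carry the padded value `t = 0` and contribute the factor `1`.
    refine prod_extend hr _ _ (fun i hi => ?_) fun i hi => ?_
    · simp only [extendZero_of_lt _ hi, Sum.elim_inl, Sum.elim_inr]
      rw [ENNReal.ofReal_mul (by positivity), ENNReal.ofReal_mul (by positivity)]
    · simp [extendZero_of_not_lt _ hi]
  have hm : Measurable fun w : Obs dX dY dZ => ENNReal.ofReal
      (shearDensity (extendZero t) (extendZero a) w *
        shearDensity (extendZero t) (extendZero a') w) := by fun_prop
  have hF : ∀ k : Fin r ⊕ Fin r, Measurable
      (Sum.elim (fun i (y : ℝ) => ENNReal.ofReal (Real.exp (t i / (1 + t i) * y ^ 2)))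
          (fun i (y : ℝ) => ENNReal.ofReal (Real.exp (-(t i / (1 - t i)) * y ^ 2))) k) := by
    rintro (i | i) <;> simp only [Sum.elim_inl, Sum.elim_inr] <;> fun_prop
  refine (lintegral_prod_symm' _ hm).trans ?_
  simp_rw [hx]
  rw [lintegral_const_mul]
  swap
  · refine Finset.measurable_prod _ fun k _ => (hF k).comp (by fun_prop)
  have hsnd : MeasurePreserving Prod.snd
    ((stdGaussian (EuclideanSpace ℝ (Fin dY))).prod (stdGaussian (EuclideanSpace ℝ (Fin dZ))))
    (stdGaussian (EuclideanSpace ℝ (Fin dZ))) := measurePreserving_snd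
  have hz := hsnd.lintegral_comp (f := fun z => ∏ k : Fin r ⊕ Fin r,
        Sum.elim (fun i (y : ℝ) => ENNReal.ofReal (Real.exp (t i / (1 + t i) * y ^ 2)))
          (fun i (y : ℝ) => ENNReal.ofReal (Real.exp (-(t i / (1 - t i)) * y ^ 2))) k
            (inner ℝ (Sum.elim p q k) z))
    (Finset.measurable_prod _ fun k _ => (hF k).comp (by fun_prop))
  simp only at hz
  rw [hz, lintegral_prod_inner_stdGaussian _ hF, Fintype.prod_sum_type, ← Finset.prod_mul_distrib,
    ← Finset.prod_mul_distrib, ENNReal.ofReal_prod_of_nonneg]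
  · refine Finset.prod_congr rfl fun i _ => ?_
    simp only [Sum.elim_inl, Sum.elim_inr]
    refine lintegral_mixed_quadratic (ht i).1 (ht i).2 ?_ ?_
    · rw [Real.coe_toNNReal _ real_inner_self_nonneg, hpp, if_pos rfl]
    · rw [Real.coe_toNNReal _ real_inner_self_nonneg, hqq, if_pos rfl]
  · intro i _
    -- The squared norm of `q i` is nonnegative, which gives `c i ≤ 1`.
    have h1 : 0 ≤ (1 - c i) / 2 := by
      have := hqq i i; rw [if_pos rfl] at this; rw [← this]; exact real_inner_self_nonneg
    have := (ht i).1
    have := (ht i).2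
    exact inv_nonneg.2 (by nlinarith)
  · rintro (i | i) (j | j) hij
    · simp only [Sum.elim_inl]; rw [hpp, if_neg fun h => hij (by rw [h])]
    · exact hpq i j
    · simp only [Sum.elim_inl, Sum.elim_inr]; rw [real_inner_comm]; exact hpq j i
    · simp only [Sum.elim_inr]; rw [hqq, if_neg fun h => hij (by rw [h])]

/-! ### Averages over sign patterns -/

/-- A product of two signs is `-1` exactly on the symmetric difference. -/
lemma sum_sign_mul_sign {d : ℕ} (s t : Finset (Fin d)) :
    ∑ j, ((if j ∈ s then -1 else 1 : ℝ) * if j ∈ t then -1 else 1) = d - 2 * (s ∆ t).card := by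
  have h : ∀ j, ((if j ∈ s then -1 else 1 : ℝ) * if j ∈ t then -1 else 1) =
      1 - 2 * if j ∈ s ∆ t then 1 else 0 := fun j => by
    simp only [Finset.mem_symmDiff]
    by_cases h1 : j ∈ s <;> by_cases h2 : j ∈ t <;> simp [h1, h2] <;> norm_num
  simp_rw [h, Finset.sum_sub_distrib, ← Finset.mul_sum]
  simp

/-- The unit vectors obtained by putting signs on disjoint blocks of coordinates. -/
noncomputable def signVec {r d m : ℕ} (e : Fin r × Fin d ↪ Fin m) (τ : Fin r → Finset (Fin d))
    (i : Fin r) : EuclideanSpace ℝ (Fin m) :=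
  ∑ j, ((if j ∈ τ i then -1 else 1) / √d) • EuclideanSpace.basisFun (Fin m) ℝ (e (i, j))

lemma inner_signVec {r d m : ℕ} (e : Fin r × Fin d ↪ Fin m) (τ σ : Fin r → Finset (Fin d))
    (i k : Fin r) : inner ℝ (signVec e τ i) (signVec e σ k) =
      if i = k then (d - 2 * (τ i ∆ σ i).card : ℝ) / d else 0 := by
  unfold signVec
  simp only [sum_inner, inner_sum, inner_smul_left, inner_smul_right,
    OrthonormalBasis.inner_eq_ite, EmbeddingLike.apply_eq_iff_eq, Prod.mk.injEq]
  split_ifs with h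
  · subst h
    simp only [true_and, mul_ite, mul_one, mul_zero, Finset.sum_ite_eq',
      Finset.mem_univ, if_true]
    rw [← sum_sign_mul_sign, Finset.sum_div]
    refine Finset.sum_congr rfl fun j _ => ?_
    have : (√(d : ℝ)) * √d = d := Real.mul_self_sqrt (Nat.cast_nonneg d)
    simp only [conj_trivial]
    rw [div_mul_div_comm, mul_comm (if j ∈ σ i then (-1 : ℝ) else 1), this]
  · simp [h]

/-- For fixed `τ` the map `σ ↦ τ ∆ σ` is an involution, so the inner sum does not depend on `τ` and
one average disappears. What remains is a product over blocks, and the cardinality of a uniform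
subset of a block is binomial `(d, 1/2)`. -/
lemma average_prod_symmDiff {r d : ℕ} (g : Fin r → ℕ → ℝ) :
    (Fintype.card (Fin r → Finset (Fin d)) : ℝ)⁻¹ ^ 2 *
        ∑ τ : Fin r → Finset (Fin d), ∑ σ : Fin r → Finset (Fin d), ∏ i, g i (τ i ∆ σ i).card =
      ∏ i, ∑ k ∈ Finset.range (d + 1), (d.choose k : ℝ) / 2 ^ d * g i k := by
  have hshift : ∀ τ : Fin r → Finset (Fin d),
      ∑ σ : Fin r → Finset (Fin d), ∏ i, g i (τ i ∆ σ i).card =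
        ∑ σ : Fin r → Finset (Fin d), ∏ i, g i (σ i).card := fun τ => by
    have hinv : Function.Involutive fun (σ : Fin r → Finset (Fin d)) i => τ i ∆ σ i := fun σ => by
      ext1 i; exact symmDiff_symmDiff_cancel_left _ _
    exact Fintype.sum_bijective _ hinv.bijective _ _ fun σ => rfl
  have hcard : (Fintype.card (Fin r → Finset (Fin d)) : ℝ) = ∏ _i : Fin r, (2 : ℝ) ^ d := by
    simp [Fintype.card_finset]
  have hpos : (∏ _i : Fin r, (2 : ℝ) ^ d) ≠ 0 := by positivity
  have hsum : ∀ i, ∑ s : Finset (Fin d), g i s.card =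
      ∑ k ∈ Finset.range (d + 1), (d.choose k : ℝ) * g i k := fun i => by
    have := Finset.sum_powerset_apply_card (g i) (x := (Finset.univ : Finset (Fin d)))
    simpa using this
  simp_rw [hshift]
  rw [Finset.sum_const, Finset.card_univ, nsmul_eq_mul, ← mul_assoc, hcard, sq, mul_assoc
    (∏ _i : Fin r, (2 : ℝ) ^ d)⁻¹, inv_mul_cancel₀ hpos, mul_one]
  have hprod : ∑ σ : Fin r → Finset (Fin d), ∏ i, g i (σ i).card =
      ∏ i, ∑ s : Finset (Fin d), g i s.card := by
    rw [Finset.prod_univ_sum, Fintype.piFinset_univ]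
  rw [hprod, ← Finset.prod_inv_distrib, ← Finset.prod_mul_distrib]
  refine Finset.prod_congr rfl fun i _ => ?_
  rw [hsum, Finset.mul_sum]
  refine Finset.sum_congr rfl fun k _ => ?_
  ring

lemma sum_choose_explained {s : ℝ} (hs : s ∈ Set.Ioo (0 : ℝ) 1) {d : ℕ} (hd : d ≠ 0) (n : ℕ) :
    ∑ k ∈ Finset.range (d + 1), (d.choose k : ℝ) / 2 ^ d *
        ((1 - (d - 2 * (k : ℝ)) / d * explained s)⁻¹) ^ n =
      (1 + s) ^ n * ∑ k ∈ Finset.range (d + 1),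
        (d.choose k : ℝ) / (2 ^ d * (1 + (3 - 4 * (k : ℝ) / (d : ℝ)) * s) ^ n) := by
  obtain ⟨h0, h1⟩ := hs
  have hd' : (d : ℝ) ≠ 0 := by exact_mod_cast hd
  -- The substitution `k ↦ d - k` is what produces `3 - 4 k / d` in place of `4 k / d - 1`.
  rw [← Finset.sum_range_reflect, Finset.mul_sum]
  refine Finset.sum_congr rfl fun k hk => ?_
  have hk : k ≤ d := Nat.lt_succ_iff.1 (Finset.mem_range.1 hk)
  have e : d + 1 - 1 - k = d - k := by omega
  rw [e, Nat.choose_symm hk, Nat.cast_sub hk]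
  have hval : (1 - (d - 2 * ((d : ℝ) - k)) / d * explained s)⁻¹ =
      (1 + s) * (1 + (3 - 4 * (k : ℝ) / (d : ℝ)) * s)⁻¹ := by
    have : 1 - (d - 2 * ((d : ℝ) - k)) / d * explained s =
        (1 + (3 - 4 * (k : ℝ) / (d : ℝ)) * s) / (1 + s) := by
      have : (1 + s) ≠ 0 := by linarith
      unfold explained
      field_simp
      ring
    rw [this, inv_div, div_eq_mul_inv]
  rw [hval, mul_pow, inv_pow, div_mul_eq_div_div, div_eq_mul_inv _ ((1 + _) ^ n)]
  ring

/-- The sum is the `d`-th Bernstein polynomial, at `1 / 2`, of `x ↦ (1 + (3 - 4 x) s) ^ (-n)`, whose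
value there is `(1 + s) ^ (-n)`. -/
lemma tendsto_sum_choose {s : ℝ} (hs : s ∈ Set.Ioo (0 : ℝ) 1) (n : ℕ) :
    Filter.Tendsto (fun d : ℕ => (1 + s) ^ n * ∑ k ∈ Finset.range (d + 1),
      (d.choose k : ℝ) / (2 ^ d * (1 + (3 - 4 * (k : ℝ) / (d : ℝ)) * s) ^ n))
      Filter.atTop (nhds 1) := by
  obtain ⟨h0, h1⟩ := hs
  -- The expression is affine in `x`, falling from `1 + 3 s` at `0` to `1 - s > 0` at `1`.
  have hpos : ∀ x : unitInterval, 0 < 1 + (3 - 4 * (x : ℝ)) * s := fun x => by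
    nlinarith [x.2.1, x.2.2]
  let f : C(unitInterval, ℝ) :=
    ⟨fun x => ((1 + (3 - 4 * (x : ℝ)) * s) ^ n)⁻¹,
      Continuous.inv₀ (by fun_prop) fun x => (pow_pos (hpos x) n).ne'⟩
  let x₀ : unitInterval := ⟨1 / 2, by norm_num, by norm_num⟩
  have hB := ((continuous_eval_const (F := C(unitInterval, ℝ)) x₀).tendsto f).comp
    (bernsteinApproximation_uniform f)
  have hf : f x₀ = ((1 + s) ^ n)⁻¹ := by
    change ((1 + (3 - 4 * (1 / 2 : ℝ)) * s) ^ n)⁻¹ = _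
    norm_num
  rw [hf] at hB
  have hlim := hB.const_mul ((1 + s) ^ n)
  rw [mul_inv_cancel₀ (by positivity)] at hlim
  refine hlim.congr fun d => ?_
  simp only [Function.comp_apply, bernsteinApproximation.apply]
  congr 1
  rw [Finset.sum_range]
  refine Finset.sum_congr rfl fun k _ => ?_
  have hk : (k : ℕ) ≤ d := Nat.lt_succ_iff.1 k.isLt
  have hb : bernstein d k x₀ = (d.choose k : ℝ) / 2 ^ d := by
    rw [bernstein_apply]
    change (d.choose k : ℝ) * (1 / 2) ^ (k : ℕ) * (1 - 1 / 2) ^ (d - k : ℕ) = _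
    rw [show (1 - 1 / 2 : ℝ) = 1 / 2 by norm_num, mul_assoc, ← pow_add, Nat.add_sub_cancel' hk,
      one_div, inv_pow, div_eq_mul_inv]
  have hfk : f (bernstein.z k) = ((1 + (3 - 4 * ((k : ℕ) : ℝ) / (d : ℝ)) * s) ^ n)⁻¹ := by
    change ((1 + (3 - 4 * (((k : ℕ) : ℝ) / (d : ℝ))) * s) ^ n)⁻¹ = _
    rw [mul_div_assoc]
  rw [hb, hfk, smul_eq_mul, div_mul_eq_div_div, div_eq_mul_inv _ ((1 + _) ^ n)]

lemma tendsto_powerBound {r : ℕ} (hr : 0 < r) (n : ℕ) {ρ : Fin r → ℝ}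
    (hρ : ∀ i, ρ i ∈ Set.Ioo (0 : ℝ) 1) (α : ℝ) :
    Filter.Tendsto (fun dZ : ℕ => powerBound n ρ dZ α) Filter.atTop (nhds α) := by
  have hdiv : Filter.Tendsto (fun dZ : ℕ => dZ / r) Filter.atTop Filter.atTop :=
    Nat.tendsto_div_const_atTop hr.ne'
  have hprod := tendsto_finsetProd Finset.univ fun i _ =>
    (tendsto_sum_choose (hρ i) n).comp hdiv
  have hsqrt := ((Real.continuous_sqrt.tendsto _).comp (hprod.const_add (-1))).const_mul (1 / 2)
  have := hsqrt.const_add α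
  simp only [Finset.prod_const_one, neg_add_cancel, Real.sqrt_zero, mul_zero, add_zero] at this
  exact this

/-! ### The power bound -/

lemma explained_extendZero {r m : ℕ} (ρ : Fin r → ℝ) :
    (fun i : Fin m => explained (extendZero ρ i)) = extendZero fun i => explained (ρ i) := by
  ext1 i
  by_cases h : (i : ℕ) < r
  · simp only [extendZero_of_lt _ h]
  · simp [extendZero_of_not_lt _ h]

lemma integrable_and_integral_of_lintegral_ofReal {Ω : Type*} [MeasurableSpace Ω] {μ : Measure Ω}
    {f : Ω → ℝ} (hf : Measurable f) (hf0 : ∀ x, 0 ≤ f x) {c : ℝ} (hc : 0 ≤ c)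
    (h : ∫⁻ x, ENNReal.ofReal (f x) ∂μ = ENNReal.ofReal c) : Integrable f μ ∧ ∫ x, f x ∂μ = c := by
  refine ⟨(lintegral_ofReal_ne_top_iff_integrable hf.aestronglyMeasurable (.of_forall hf0)).1
    (h ▸ ENNReal.ofReal_ne_top), ?_⟩
  rw [integral_eq_lintegral_of_nonneg_ae (.of_forall hf0) hf.aestronglyMeasurable, h,
    ENNReal.toReal_ofReal hc]

lemma rejectionProb_sampleLaw_map {n : ℕ} {ψ : (Fin n → Obs dX dY dZ) → ℝ} (hψ : IsTest ψ)
    {μ : Measure (Obs dX dY dZ)} [IsProbabilityMeasure μ] {T : Obs dX dY dZ → Obs dX dY dZ}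
    (hT : Measurable T) :
    rejectionProb ψ (sampleLaw n (μ.map T)) =
      ∫ x, ψ (fun j => T (x j)) ∂Measure.pi fun _ : Fin n => μ := by
  have := Measure.isProbabilityMeasure_map (μ := μ) hT.aemeasurable
  have hT' : Measurable fun (x : Fin n → Obs dX dY dZ) j => T (x j) :=
    measurable_pi_lambda _ fun j => hT.comp (measurable_pi_apply j)
  rw [rejectionProb, sampleLaw, ← Measure.pi_map_pi fun _ => hT.aemeasurable,
    integral_map hT'.aemeasurable hψ.measurable.aestronglyMeasurable]

lemma rejectionProb_sampleLaw_withDensity {n : ℕ} {ψ : (Fin n → Obs dX dY dZ) → ℝ}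
    {μ : Measure (Obs dX dY dZ)} [IsProbabilityMeasure μ] {L : Obs dX dY dZ → ℝ}
    (hL : Measurable L) (hL0 : ∀ w, 0 ≤ L w)
    [IsProbabilityMeasure (μ.withDensity fun w => ENNReal.ofReal (L w))] :
    ∫ x, ψ x ∂Measure.pi (fun _ : Fin n => μ.withDensity fun w => ENNReal.ofReal (L w)) =
      ∫ x, ψ x * ∏ j, L (x j) ∂Measure.pi fun _ : Fin n => μ := by
  rw [pi_withDensity (fun _ : Fin n => μ) (f := fun _ w => ENNReal.ofReal (L w))
    fun _ => by fun_prop]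
  simp_rw [← ENNReal.ofReal_prod_of_nonneg fun _ _ => hL0 _]
  rw [integral_withDensity_eq_integral_toReal_smul (by fun_prop)
    (.of_forall fun _ => ENNReal.ofReal_lt_top)]
  refine integral_congr_ae (.of_forall fun x => ?_)
  simp only [smul_eq_mul]
  rw [ENNReal.toReal_ofReal (Finset.prod_nonneg fun _ _ => hL0 _), mul_comm]

lemma rejectionProb_le_testSize {Ω : Type*} [MeasurableSpace Ω] {ψ : Ω → ℝ} (hψ : IsTest ψ)
    {H : Set (Measure Ω)} (hH : ∀ P ∈ H, IsProbabilityMeasure P) {P : Measure Ω} (hP : P ∈ H) :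
    rejectionProb ψ P ≤ testSize ψ H := by
  -- The real `sSup` of an unbounded set is `0`, so boundedness has to be supplied; rejection
  -- probabilities are at most `1`.
  refine le_csSup ⟨1, ?_⟩ ⟨P, hP, rfl⟩
  rintro _ ⟨ν, hν, rfl⟩
  have := hH ν hν
  calc rejectionProb ψ ν ≤ ∫ _, (1 : ℝ) ∂ν :=
        integral_mono_of_nonneg (.of_forall fun x => (hψ.mem_Icc x).1) (integrable_const _)
          (.of_forall fun x => (hψ.mem_Icc x).2)
    _ = 1 := by simp

lemma isProbabilityMeasure_of_mem_nullFamily {n : ℕ} {Q : Measure (Obs dX dY dZ)}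
    {R : Measure (Fin n → Obs dX dY dZ)} (hR : R ∈ nullFamily n Q) : IsProbabilityMeasure R := by
  obtain ⟨P, ⟨hP, -⟩, rfl⟩ := hR
  have := hP.1.gaussian
  unfold sampleLaw
  infer_instance

lemma rejectionProb_le_powerBound {n : ℕ} {ρ : Fin (min dX dY) → ℝ} (hr : 0 < min dX dY)
    (hρ : ∀ i, ρ i ∈ Set.Ioo (0 : ℝ) 1) (hdZ : min dX dY ≤ dZ) {Q : Measure (Obs dX dY dZ)}
    (hQ : IsStandardLaw ρ Q) {ψ : (Fin n → Obs dX dY dZ) → ℝ} (hψ : IsTest ψ) {α : ℝ}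
    (hα : testSize ψ (nullFamily n Q) ≤ α) :
    rejectionProb ψ (sampleLaw n Q) ≤ powerBound n ρ dZ α := by
  set d := dZ / min dX dY with hd_def
  have hd : d ≠ 0 := (Nat.div_pos hdZ hr).ne'
  have hd' : (d : ℝ) ≠ 0 := by exact_mod_cast hd
  have hρ' : ∀ i, ρ i ∈ Set.Ico (0 : ℝ) 1 := fun i => ⟨(hρ i).1.le, (hρ i).2⟩
  obtain rfl : Q = (stdLaw dX dY dZ).map (correlate dZ ρ) :=
    hQ.unique (isStandardLaw_correlate hρ')
  -- As `r * d ≤ dZ`, the coordinates of `Z` contain `r` disjoint blocks of length `d`, one for each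
  -- correlation.
  let e : Fin (min dX dY) × Fin d ↪ Fin dZ :=
    finProdFinEquiv.toEmbedding.trans (Fin.castLEEmb (Nat.mul_div_le dZ (min dX dY)))
  set t : Fin (min dX dY) → ℝ := fun i => explained (ρ i) with ht_def
  have ht : ∀ i, t i ∈ Set.Ico (0 : ℝ) 1 := fun i => explained_mem_Ico (hρ' i)
  let a : (Fin (min dX dY) → Finset (Fin d)) → Fin (min dX dY) → EuclideanSpace ℝ (Fin dZ) := signVec e
  let L : (Fin (min dX dY) → Finset (Fin d)) → Obs dX dY dZ → ℝ := fun τ =>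
    shearDensity (extendZero t) (extendZero (a τ))
  have hLm : ∀ τ, Measurable (L τ) := fun τ => measurable_shearDensity _ _
  have hL0 : ∀ τ w, 0 ≤ L τ w := fun τ => shearDensity_nonneg _ _
  have ht1 : ∀ i : Fin dX, extendZero t i < 1 := fun i => (extendZero_mem_Ico ht i).2
  have hprob : ∀ τ, IsProbabilityMeasure
      ((stdLaw dX dY dZ).withDensity fun w => ENNReal.ofReal (L τ w)) := fun τ => by
    rw [← map_shear ht1]
    exact Measure.isProbabilityMeasure_map (by fun_prop)
  have hL1 : ∀ τ, ∫ w, L τ w ∂stdLaw dX dY dZ = 1 := fun τ => by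
    refine (integrable_and_integral_of_lintegral_ofReal (hLm τ) (hL0 τ) zero_le_one ?_).2
    rw [ENNReal.ofReal_one, ← (hprob τ).measure_univ, withDensity_apply _ .univ,
      Measure.restrict_univ]
  let k : Fin (min dX dY) → ℕ → ℝ := fun i m => (1 - (d - 2 * (m : ℝ)) / d * t i)⁻¹
  have hone : ∀ (τ : Fin (min dX dY) → Finset (Fin d)) i j, inner ℝ (a τ i) (a τ j) =
      if i = j then (1 : ℝ) else 0 := fun τ i j => by
    rw [inner_signVec, symmDiff_self]
    simp [hd']
  have hk0 : ∀ (τ σ : Fin (min dX dY) → Finset (Fin d)) i, 0 ≤ k i (τ i ∆ σ i).card := fun τ σ i => by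
    have hc : ((τ i ∆ σ i).card : ℝ) ≤ d := by
      exact_mod_cast (Finset.card_le_univ _).trans_eq (Fintype.card_fin d)
    have hc1 : (d - 2 * ((τ i ∆ σ i).card : ℝ)) / d ≤ 1 := by
      rw [div_le_one (by positivity)]
      linarith [Nat.cast_nonneg (α := ℝ) (τ i ∆ σ i).card]
    exact inv_nonneg.2 (by nlinarith [(ht i).1, (ht i).2])
  have hLL : ∀ τ σ, Integrable (fun w => L τ w * L σ w) (stdLaw dX dY dZ) ∧
      ∫ w, L τ w * L σ w ∂stdLaw dX dY dZ = ∏ i, k i (τ i ∆ σ i).card := fun τ σ => by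
    refine integrable_and_integral_of_lintegral_ofReal ((hLm τ).mul (hLm σ))
      (fun w => mul_nonneg (hL0 τ w) (hL0 σ w)) (Finset.prod_nonneg fun i _ => hk0 τ σ i) ?_
    exact lintegral_shearDensity_mul_shearDensity (min_le_left _ _) ht (hone τ) (hone σ)
      fun i j => inner_signVec e τ σ i j
  -- Each confounded law is a null law with the `Z`-marginal of `Q`, so the size bound applies; it
  -- is then transported to `stdLaw` through the density `L τ`.
  have hnull : ∀ τ, ∫ x, ψ (fun j => correlate dZ ρ (x j)) * ∏ j, L τ (x j)
      ∂Measure.pi (fun _ : Fin n => stdLaw dX dY dZ) ≤ α := fun τ => by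
    have hmem : sampleLaw n ((stdLaw dX dY dZ).map (confound ρ (a τ))) ∈
        nullFamily n ((stdLaw dX dY dZ).map (correlate dZ ρ)) :=
      ⟨_, ⟨isNullLaw_confound hρ' _, by rw [map_snd_snd_confound, map_snd_snd_correlate]⟩, rfl⟩
    have h := (rejectionProb_le_testSize hψ
      (fun _ => isProbabilityMeasure_of_mem_nullFamily) hmem).trans hα
    rw [map_confound_eq hρ', explained_extendZero] at h
    have := hprob τ
    rw [rejectionProb_sampleLaw_map hψ (by fun_prop)] at h
    rwa [rejectionProb_sampleLaw_withDensity (ψ := fun x => ψ fun j => correlate dZ ρ (x j))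
      (hLm τ) (hL0 τ)] at h
  have hψ' : IsTest fun x : Fin n → Obs dX dY dZ => ψ fun j => correlate dZ ρ (x j) :=
    ⟨hψ.measurable.comp (by fun_prop), fun x => hψ.mem_Icc _⟩
  -- Independence of the observations turns the one-observation second moments into their `n`-th
  -- powers.
  have hbound := rejectionProb_le_of_mixture (μ := Measure.pi fun _ : Fin n => stdLaw dX dY dZ)
    hψ' (f := fun τ x => ∏ j, L τ (x j)) (K := fun τ σ => ∏ i, k i (τ i ∆ σ i).card ^ n)
    (fun τ => by rw [integral_fintype_prod_eq_pow, hL1, one_pow])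
    (fun τ => by
      rw [memLp_two_iff_integrable_sq (Measurable.aestronglyMeasurable (by fun_prop))]
      simp_rw [← Finset.prod_pow, sq]
      exact Integrable.fintype_prod fun _ => (hLL τ τ).1)
    (fun τ σ => by
      simp_rw [← Finset.prod_mul_distrib]
      rw [integral_fintype_prod_eq_pow (fun w => L τ w * L σ w), (hLL τ σ).2, Fintype.card_fin,
        Finset.prod_pow])
    hnull
  rw [rejectionProb_sampleLaw_map hψ (by fun_prop)]
  refine hbound.trans_eq ?_
  rw [average_prod_symmDiff fun i m => k i m ^ n]
  unfold powerBound
  congr 3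
  refine congrArg _ (Finset.prod_congr rfl fun i _ => ?_)
  exact sum_choose_explained (hρ i) hd n

end GaussianCI

theorem mainTheorem7 (dX dY n : ℕ) (hX : 1 ≤ dX) (hY : 1 ≤ dY)
    (ρ : Fin (min dX dY) → ℝ) (hρ : ∀ i, ρ i ∈ Set.Ioo (0 : ℝ) 1) (α : ℝ) :
    (∀ dZ : ℕ, min dX dY ≤ dZ →
      ∀ Q : MeasureTheory.Measure (GaussianCI.Obs dX dY dZ), GaussianCI.IsStandardLaw ρ Q →
      ∀ ψ : (Fin n → GaussianCI.Obs dX dY dZ) → ℝ, GaussianCI.IsTest ψ →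
      GaussianCI.testSize ψ (GaussianCI.nullFamily n Q) ≤ α →
      GaussianCI.rejectionProb ψ (GaussianCI.sampleLaw n Q) ≤ GaussianCI.powerBound n ρ dZ α) ∧
    Filter.Tendsto (fun dZ : ℕ => GaussianCI.powerBound n ρ dZ α) Filter.atTop (nhds α) := by
  have hr : 0 < min dX dY := lt_min hX hY
  exact ⟨fun _ hdZ _ hQ _ hψ hα => GaussianCI.rejectionProb_le_powerBound hr hρ hdZ hQ hψ hα,
    GaussianCI.tendsto_powerBound hr n hρ α⟩
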